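/- **Proposition 2.1.** Let $0\le k\le n$, let $a=\mathrm{diag}(\tfrac i2 I_k,-\tfrac i2 I_{n-k})\in u(n)$, let $\langle x,y\rangle=-\mathrm{tr}(xy)$ on $u(n)$, and let $M=\{gag^{-1}: g\in U(n)\}\subset u(n)$ be the adjoint $U(n)$-orbit of $a$. Let $Gr(k,\mathbb C^n)$ be the complex manifold of $k$-dimensional linear subspaces of $\mathbb C^n$, with $T_V\,Gr(k,\mathbb C^n)=\mathrm{Hom}_{\mathbb C}(V,V^\perp)$, complex structure $J=$ multiplication by $i$, and metric $g_V(A,B)=2\,\mathrm{Re}\,\mathrm{tr}(A^*B)$. 1. $g$ is a smooth Kähler metric, and with it $Gr(k,\mathbb C^n)$ is a Hermitian symmetric space: a connected (Hausdorff, second countable) complex manifold with a Hermitian metric in which every point is an isolated fixed point of an involutive holomorphic isometry. 2. There is a smooth embedding $\Theta:Gr(k,\mathbb C^n)\to u(n)$ with image $M$, for which $V$ is the eigenspace of $\Theta(V)$ for the eigenvalue $i/2$, and the metric on $M$ induced by $\langle\cdot,\cdot\rangle$ corresponds to $g$: $g_V(A,B)=\langle d\Theta_V A,d\Theta_V B\rangle$.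 Thus $M$ with the induced metric is the Hermitian symmetric space $Gr(k,\mathbb C^n)$. 3. Let $\mathcal U\subset\mathbb R^2$ be open. A map $\gamma:\mathcal U\to Gr(k,\mathbb C^n)$, $(x,t)\mapsto\gamma(x,t)$, is smooth if and only if $\Theta\circ\gamma:\mathcal U\to u(n)$ is; and a smooth $\gamma$ satisfies the geometric non-linear Schrödinger equation (GNLS) $$J_\gamma\gamma_t=\nabla_{\gamma_x}\gamma_x$$ on $\mathcal U$, where $\nabla$ is the Levi-Civita connection of $g$, if and only if the $M$-valued map $\Theta\circ\gamma$, written again $\gamma$, satisfies $$\gamma_t=[\gamma,\gamma_{xx}]\quad\text{on }\mathcal U .$$ -/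

import Mathlib

open scoped Manifold ContDiff InnerProductSpace
open Complex (I)
open ContinuousLinearMap (adjoint)

noncomputable section

/-! ### The geometric non-linear Schroedinger equation on a Kaehler manifold

`M` is a complex manifold modelled on the complex vector space `E`; its underlying real manifold
is described by the same charts, through the model `𝓘(ℝ, E)`. -/

section Kaehler

variable {E : Type*} [NormedAddCommGroup E] [NormedSpace ℝ E] [NormedSpace ℂ E]
  [IsScalarTower ℝ ℂ E]
  {M : Type*} [TopologicalSpace M] [ChartedSpace E M]

/-- The complex structure `J` on the real tangent space of a complex manifold: multiplication by
`i` (in any complex chart). -/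
def complexStructure (p : M) : TangentSpace 𝓘(ℝ, E) p →L[ℝ] TangentSpace 𝓘(ℝ, E) p :=
  show E →L[ℝ] E from I • ContinuousLinearMap.id ℝ E

variable [IsManifold 𝓘(ℝ, E) ∞ M]

/-- A smooth Riemannian metric on the manifold `M`. -/
abbrev RiemMetric (E : Type*) [NormedAddCommGroup E] [NormedSpace ℝ E]
    (M : Type*) [TopologicalSpace M] [ChartedSpace E M] [IsManifold 𝓘(ℝ, E) ∞ M] :=
  Bundle.ContMDiffRiemannianMetric 𝓘(ℝ, E) ∞ E (fun p : M => TangentSpace 𝓘(ℝ, E) p)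

/-- The coordinate vector field of the chart at `p` with constant coefficients `v`, at the point
of `M` with coordinates `z`. -/
def coordVector (p : M) (z v : E) : TangentSpace 𝓘(ℝ, E) ((chartAt E p).symm z) :=
  mfderiv 𝓘(ℝ, E) 𝓘(ℝ, E) (chartAt E p).symm z v

/-- The coefficients `g_{vw}(z)` of the metric in the chart at `p`. -/
def metricCoeff (g : RiemMetric E M) (p : M) (z v w : E) : ℝ :=
  g.inner ((chartAt E p).symm z) (coordVector p z v) (coordVector p z w)

/-- The Christoffel symbols of the first kind of the Levi-Civita connection in the chart at `p`,
`½ (∂_u g_{vw} + ∂_v g_{uw} - ∂_w g_{uv})`. -/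
def christoffel (g : RiemMetric E M) (p : M) (z u v w : E) : ℝ :=
  (fderiv ℝ (fun y => metricCoeff g p y v w) z u + fderiv ℝ (fun y => metricCoeff g p y u w) z v
    - fderiv ℝ (fun y => metricCoeff g p y u v) z w) / 2

/-- `ξ = ∇_{c'} c'` at the parameter `s`, where `∇` is the Levi-Civita connection of `g`: in the
chart at `c s`, with `u` the coordinate expression of `c`, one has
`g(ξ, w) = g(u'', w) + Γ(u', u', w)` for every tangent vector `w`. (Tangent vectors at `c s` are
identified in Mathlib with their coordinates in the chart at `c s`.) -/
def IsCovariantAcceleration (g : RiemMetric E M) (c : ℝ → M) (s : ℝ)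
    (ξ : TangentSpace 𝓘(ℝ, E) (c s)) : Prop :=
  let u : ℝ → E := fun r => chartAt E (c s) (c r)
  ∀ w : TangentSpace 𝓘(ℝ, E) (c s),
    g.inner (c s) ξ w =
      g.inner (c s) (show TangentSpace 𝓘(ℝ, E) (c s) from (iteratedDeriv 2 u s : E)) w
        + christoffel g (c s) (u s) (deriv u s) (deriv u s) w

/-- The geometric non-linear Schroedinger equation `J_γ γ_t = ∇_{γ_x} γ_x` at the point `(x, t)`
for a map `γ(x, t)` into `M`. -/
def GNLSAt (g : RiemMetric E M) (γ : ℝ × ℝ → M) (x t : ℝ) : Prop :=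
  IsCovariantAcceleration g (fun r => γ (r, t)) x
    (complexStructure (γ (x, t)) (mfderiv 𝓘(ℝ, ℝ) 𝓘(ℝ, E) (fun r => γ (x, r)) t (1 : ℝ)))

/-- The metric is Hermitian: `g(Jv, Jw) = g(v, w)`. -/
def IsHermitianMetric (g : RiemMetric E M) : Prop :=
  ∀ (p : M) (v w : TangentSpace 𝓘(ℝ, E) p),
    g.inner p (complexStructure p v) (complexStructure p w) = g.inner p v w

/-- The coefficients of the two-form `τ(v, w) = g(Jv, w)` in the chart at `p`. -/
def kaehlerFormCoeff (g : RiemMetric E M) (p : M) (z v w : E) : ℝ :=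
  g.inner ((chartAt E p).symm z) (complexStructure _ (coordVector p z v)) (coordVector p z w)

/-- The metric is Kaehler: it is Hermitian and the two-form `τ(v, w) = g(Jv, w)` is closed. -/
def IsKaehlerMetric (g : RiemMetric E M) : Prop :=
  IsHermitianMetric g ∧
  ∀ (p : M) (u v w : E),
    fderiv ℝ (fun y => kaehlerFormCoeff g p y v w) (chartAt E p p) u
      + fderiv ℝ (fun y => kaehlerFormCoeff g p y w u) (chartAt E p p) v
      + fderiv ℝ (fun y => kaehlerFormCoeff g p y u v) (chartAt E p p) w = 0

/-- `s` is an isometry of `(M, g)` into itself (onto, when `s` is an involution). -/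
def PreservesMetric (g : RiemMetric E M) (s : M → M) : Prop :=
  ContMDiff 𝓘(ℝ, E) 𝓘(ℝ, E) ∞ s ∧
  ∀ (p : M) (v w : TangentSpace 𝓘(ℝ, E) p),
    g.inner (s p) (mfderiv 𝓘(ℝ, E) 𝓘(ℝ, E) s p v) (mfderiv 𝓘(ℝ, E) 𝓘(ℝ, E) s p w)
      = g.inner p v w

/-- A Hermitian symmetric space: a connected complex manifold with a Hermitian metric, each point
of which is an isolated fixed point of an involutive holomorphic isometry. -/
structure IsHermitianSymmetricSpace (g : RiemMetric E M) : Prop where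
  t2 : T2Space M
  secondCountable : SecondCountableTopology M
  connected : ConnectedSpace M
  complexManifold : IsManifold 𝓘(ℂ, E) ω M
  hermitian : IsHermitianMetric g
  symmetric : ∀ p : M, ∃ s : M → M, Function.Involutive s ∧ MDifferentiable 𝓘(ℂ, E) 𝓘(ℂ, E) s ∧
    PreservesMetric g s ∧ s p = p ∧ ∀ᶠ q in nhdsWithin p {p}ᶜ, s q ≠ q

end Kaehler

/-! ### The Grassmannian `Gr(k, ℂⁿ)` as a complex manifold -/

/-- `ℂⁿ` with its standard Hermitian inner product. -/
abbrev Cn (n : ℕ) := EuclideanSpace ℂ (Fin n)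

/-- The Grassmannian of `k`-dimensional complex linear subspaces of `ℂⁿ`. -/
def Gr (k n : ℕ) := {V : Submodule ℂ (Cn n) // Module.finrank ℂ V = k}

/-- The model space of `Gr(k, ℂⁿ)`: linear maps `ℂᵏ → ℂⁿ⁻ᵏ`. -/
def GrModel (k n : ℕ) := Cn k →L[ℂ] Cn (n - k)

instance (k n : ℕ) : NormedAddCommGroup (GrModel k n) :=
  inferInstanceAs (NormedAddCommGroup (Cn k →L[ℂ] Cn (n - k)))

instance (k n : ℕ) : NormedSpace ℂ (GrModel k n) :=
  inferInstanceAs (NormedSpace ℂ (Cn k →L[ℂ] Cn (n - k)))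

namespace Gr

variable {k n : ℕ}

/-- The usual topology of the Grassmannian: that of the orthogonal projections onto the
subspaces. -/
instance : TopologicalSpace (Gr k n) :=
  TopologicalSpace.induced (fun V => V.1.starProjection) inferInstance

lemma finrank_orthogonal (V : Gr k n) : Module.finrank ℂ V.1ᗮ = n - k := by
  have h := V.1.finrank_add_finrank_orthogonal
  rw [V.2, finrank_euclideanSpace_fin] at h
  omega

/-- An isometry of `ℂᵏ` onto `V`. -/
def frame (V : Gr k n) : Cn k →ₗᵢ[ℂ] Cn n :=
  V.1.subtypeₗᵢ.comp
    ((stdOrthonormalBasis ℂ V.1).reindex (finCongr V.2)).repr.symm.toLinearIsometry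

/-- An isometry of `ℂⁿ⁻ᵏ` onto the orthogonal complement of `V`. -/
def coframe (V : Gr k n) : Cn (n - k) →ₗᵢ[ℂ] Cn n :=
  V.1ᗮ.subtypeₗᵢ.comp
    ((stdOrthonormalBasis ℂ V.1ᗮ).reindex (finCongr V.finrank_orthogonal)).repr.symm.toLinearIsometry

/-- `frame V` as a continuous linear map. -/
abbrev e (V : Gr k n) : Cn k →L[ℂ] Cn n := V.frame.toContinuousLinearMap

/-- `coframe V` as a continuous linear map. -/
abbrev f (V : Gr k n) : Cn (n - k) →L[ℂ] Cn n := V.coframe.toContinuousLinearMap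

lemma e_mem (V : Gr k n) (x) : V.e x ∈ V.1 := by simp [e, frame]

lemma f_mem (V : Gr k n) (x) : V.f x ∈ V.1ᗮ :=  by
  simp only [f, coframe, LinearIsometry.coe_toContinuousLinearMap]
  exact Subtype.coe_prop _

lemma range_e (V : Gr k n) {x} (hx : x ∈ V.1) : ∃ y, V.e y = x :=
  ⟨((stdOrthonormalBasis ℂ V.1).reindex (finCongr V.2)).repr ⟨x, hx⟩, by simp [e, frame]⟩

lemma range_f (V : Gr k n) {x} (hx : x ∈ V.1ᗮ) : ∃ y, V.f y = x :=
  ⟨((stdOrthonormalBasis ℂ V.1ᗮ).reindex (finCongr V.finrank_orthogonal)).repr ⟨x, hx⟩, by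
    simp [f, coframe]⟩

lemma e_e (V : Gr k n) : adjoint V.e ∘L V.e = 1 := by
  ext1 x
  refine ext_inner_right ℂ fun y => ?_
  simp

lemma f_f (V : Gr k n) : adjoint V.f ∘L V.f = 1 := by
  ext1 x
  refine ext_inner_right ℂ fun y => ?_
  simp

lemma e_f (V : Gr k n) : adjoint V.e ∘L V.f = 0 := by
  ext1 x
  refine ext_inner_right ℂ fun y => ?_
  have := Submodule.inner_left_of_mem_orthogonal (V.e_mem y) (V.f_mem x)
  simpa [ContinuousLinearMap.adjoint_inner_left] using this

lemma f_e (V : Gr k n) : adjoint V.f ∘L V.e = 0 := by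
  ext1 x
  refine ext_inner_right ℂ fun y => ?_
  have := Submodule.inner_right_of_mem_orthogonal (V.e_mem x) (V.f_mem y)
  simpa [ContinuousLinearMap.adjoint_inner_left] using this

lemma e_add_f (V : Gr k n) : V.e ∘L adjoint V.e + V.f ∘L adjoint V.f = 1 := by
  ext1 x
  obtain ⟨y, hy⟩ := V.range_e (V.1.starProjection_apply_mem x)
  obtain ⟨z, hz⟩ := V.range_f (V.1.sub_starProjection_mem_orthogonal x)
  have hx : x = V.e y + V.f z := by rw [hy, hz]; abel
  have h1 := DFunLike.congr_fun V.e_e y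
  have h2 := DFunLike.congr_fun V.f_f z
  have h3 := DFunLike.congr_fun V.e_f z
  have h4 := DFunLike.congr_fun V.f_e y
  simp only [ContinuousLinearMap.comp_apply, one_apply_eq_self,
    zero_apply] at h1 h2 h3 h4
  rw [hx]
  simp only [add_apply, ContinuousLinearMap.comp_apply,
    one_apply_eq_self, map_add, h1, h2, h3, h4]
  simp

/-- The map `x ↦ x + A x` from `V` to `ℂⁿ` whose image is the graph of `A : V → Vᗮ`. -/
def graphMap (V : Gr k n) (A : Cn k →L[ℂ] Cn (n - k)) : Cn k →L[ℂ] Cn n := V.e + V.f ∘L A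

lemma e_graphMap (V : Gr k n) (A : Cn k →L[ℂ] Cn (n - k)) : adjoint V.e ∘L V.graphMap A = 1 := by
  rw [graphMap, ContinuousLinearMap.comp_add, ← ContinuousLinearMap.comp_assoc, V.e_e, V.e_f]
  simp

lemma f_graphMap (V : Gr k n) (A : Cn k →L[ℂ] Cn (n - k)) : adjoint V.f ∘L V.graphMap A = A := by
  rw [graphMap, ContinuousLinearMap.comp_add, ← ContinuousLinearMap.comp_assoc, V.f_e, V.f_f]
  ext1 x; simp

lemma graphMap_injective (V : Gr k n) (A : Cn k →L[ℂ] Cn (n - k)) : Function.Injective (V.graphMap A) :=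
  Function.LeftInverse.injective (g := adjoint V.e)
    fun x => DFunLike.congr_fun (V.e_graphMap A) x

lemma finrank_range {T : Cn k →L[ℂ] Cn n} (hT : Function.Injective T) :
    Module.finrank ℂ T.range = k := by
  have := LinearMap.finrank_range_of_inj (f := (T : Cn k →ₗ[ℂ] Cn n)) hT
  simpa using this

/-- The graph of `A : V → Vᗮ`, as a point of the Grassmannian. -/
def graph (V : Gr k n) (A : Cn k →L[ℂ] Cn (n - k)) : Gr k n :=
  ⟨(V.graphMap A).range, finrank_range (V.graphMap_injective A)⟩

lemma isUnit_of_injective {X : Cn k →L[ℂ] Cn k} (hX : Function.Injective X) : IsUnit X := by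
  rw [ContinuousLinearMap.isUnit_iff_bijective]
  exact ⟨hX, (LinearMap.injective_iff_surjective (f := (X : Cn k →ₗ[ℂ] Cn k))).1 hX⟩

lemma isUnit_gram {T : Cn k →L[ℂ] Cn n} (hT : Function.Injective T) :
    IsUnit (adjoint T ∘L T) := by
  refine isUnit_of_injective ((injective_iff_map_eq_zero _).2 fun x hx => ?_)
  have h : ⟪T x, T x⟫_ℂ = 0 := by
    rw [← ContinuousLinearMap.adjoint_inner_left]
    simp only [ContinuousLinearMap.comp_apply] at hx
    rw [hx, inner_zero_left]
  exact hT (by rw [inner_self_eq_zero.1 h, map_zero])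

lemma starProjection_range {T : Cn k →L[ℂ] Cn n} (hT : Function.Injective T) :
    T.range.starProjection = T ∘L Ring.inverse (adjoint T ∘L T) ∘L adjoint T := by
  ext1 x
  have hm := LinearMap.mem_range_self (T : Cn k →ₗ[ℂ] Cn n)
    ((Ring.inverse (adjoint T ∘L T) ∘L adjoint T) x)
  refine (Submodule.eq_starProjection_of_mem_of_inner_eq_zero (u := x) hm ?_)
  rintro _ ⟨y, rfl⟩
  have h := DFunLike.congr_fun (Ring.mul_inverse_cancel _ (isUnit_gram hT)) (adjoint T x)
  simp only [mul_apply_eq_comp, ContinuousLinearMap.comp_apply, one_apply_eq_self] at h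
  change ⟪x - T _, T y⟫_ℂ = 0
  rw [← ContinuousLinearMap.adjoint_inner_left, map_sub, sub_eq_zero.2, inner_zero_left]
  exact h.symm

/-- The compression to `V` of the orthogonal projection onto `W`; it is invertible if and only if
`W` is the graph of a map `V → Vᗮ`. -/
def compr (V W : Gr k n) : Cn k →L[ℂ] Cn k := adjoint V.e ∘L W.1.starProjection ∘L V.e

/-- The map `V → Vᗮ` (read in orthonormal bases) of which `W` is the graph. -/
def slope (V W : Gr k n) : Cn k →L[ℂ] Cn (n - k) :=
  (adjoint V.f ∘L W.1.starProjection ∘L V.e) ∘L Ring.inverse (V.compr W)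

lemma slope_range (V : Gr k n) {T : Cn k →L[ℂ] Cn n} (hT : Function.Injective T)
    (W : Gr k n) (hW : W.1 = T.range) (hu : IsUnit (V.compr W)) :
    IsUnit (adjoint V.e ∘L T) ∧
      V.slope W = (adjoint V.f ∘L T) ∘L Ring.inverse (adjoint V.e ∘L T) := by
  obtain ⟨W', hWk⟩ := W
  have hW' : W' = T.range := hW
  subst hW'
  set Y := Ring.inverse (adjoint T ∘L T) ∘L adjoint T ∘L V.e with hY
  have h1 : V.compr ⟨T.range, hWk⟩ = (adjoint V.e ∘L T) * Y := by
    change adjoint V.e ∘L T.range.starProjection ∘L V.e = _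
    rw [starProjection_range hT]; rfl
  have h2 : adjoint V.f ∘L T.range.starProjection ∘L V.e = (adjoint V.f ∘L T) ∘L Y := by
    rw [starProjection_range hT]; rfl
  have hYinj : Function.Injective Y := by
    have := (ContinuousLinearMap.isUnit_iff_bijective.1 hu).1
    rw [h1] at this
    exact Function.Injective.of_comp (f := (adjoint V.e ∘L T)) this
  have hYu := isUnit_of_injective hYinj
  obtain ⟨y, hy⟩ := hYu
  obtain ⟨z, hz⟩ := hu
  have hX : adjoint V.e ∘L T = ((z * y⁻¹ : (Cn k →L[ℂ] Cn k)ˣ) : Cn k →L[ℂ] Cn k) := by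
    rw [Units.val_mul, hz, h1, ← hy, Units.mul_inv_cancel_right]
  refine ⟨hX ▸ Units.isUnit _, ?_⟩
  change (adjoint V.f ∘L T.range.starProjection ∘L V.e) ∘L _ = _
  rw [h2, hX, Ring.inverse_unit, ← hz, Ring.inverse_unit, mul_inv_rev, inv_inv,
    Units.val_mul, hy]
  rfl

lemma compr_graph (V : Gr k n) (A : Cn k →L[ℂ] Cn (n - k)) :
    V.compr (V.graph A) = Ring.inverse (adjoint (V.graphMap A) ∘L V.graphMap A) := by
  have h1 := V.e_graphMap A
  have h2 : adjoint (V.graphMap A) ∘L V.e = 1 := by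
    have := congrArg adjoint h1
    rwa [ContinuousLinearMap.adjoint_comp, ContinuousLinearMap.adjoint_adjoint,
      show adjoint (1 : Cn k →L[ℂ] Cn k) = 1 from star_one (Cn k →L[ℂ] Cn k)] at this
  change adjoint V.e ∘L (V.graphMap A).range.starProjection ∘L V.e = _
  rw [starProjection_range (V.graphMap_injective A)]
  ext1 x
  have h3 := DFunLike.congr_fun h2 x
  simp only [ContinuousLinearMap.comp_apply, one_apply_eq_self] at h3
  simp only [ContinuousLinearMap.comp_apply, h3]
  exact DFunLike.congr_fun h1 _

lemma isUnit_compr_graph (V : Gr k n) (A : Cn k →L[ℂ] Cn (n - k)) : IsUnit (V.compr (V.graph A)) := by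
  rw [compr_graph]
  exact (isUnit_gram (V.graphMap_injective A)).ringInverse

lemma slope_graph (V : Gr k n) (A : Cn k →L[ℂ] Cn (n - k)) : V.slope (V.graph A) = A := by
  rw [(V.slope_range (V.graphMap_injective A) _ rfl (V.isUnit_compr_graph A)).2, f_graphMap,
    e_graphMap, Ring.inverse_one]
  rfl

lemma graph_slope (V W : Gr k n) (h : IsUnit (V.compr W)) : V.graph (V.slope W) = W := by
  have key : V.graphMap (V.slope W) = W.1.starProjection ∘L V.e ∘L Ring.inverse (V.compr W) := by
    have h1 : V.e = V.e ∘L (V.compr W) ∘L Ring.inverse (V.compr W) := by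
      have := Ring.mul_inverse_cancel _ h
      rw [ContinuousLinearMap.mul_def] at this
      rw [this]; rfl
    rw [graphMap]
    conv_lhs => rw [h1]
    rw [slope, compr]
    ext1 x
    exact DFunLike.congr_fun V.e_add_f (W.1.starProjection (V.e (Ring.inverse (V.compr W) x)))
  refine Subtype.ext (Submodule.eq_of_le_of_finrank_eq ?_ ?_)
  · rintro _ ⟨x, rfl⟩
    change V.graphMap (V.slope W) x ∈ W.1
    rw [key]
    exact W.1.starProjection_apply_mem _
  · rw [W.2, (V.graph _).2]

lemma continuous_starProjection :
    Continuous (fun W : Gr k n => W.1.starProjection) := continuous_induced_dom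

lemma continuous_compr (V : Gr k n) : Continuous V.compr :=
  continuous_const.clm_comp (continuous_starProjection.clm_comp continuous_const)

lemma continuousAt_inverse {X : Cn k →L[ℂ] Cn k} (h : IsUnit X) :
    ContinuousAt Ring.inverse X := by
  obtain ⟨u, rfl⟩ := h
  exact NormedRing.inverse_continuousAt u

lemma continuous_graphMap (V : Gr k n) : Continuous V.graphMap :=
  continuous_const.add (continuous_const.clm_comp continuous_id)

lemma continuousAt_slope (V W : Gr k n) (h : IsUnit (V.compr W)) : ContinuousAt V.slope W := by
  refine ContinuousAt.clm_comp ?_ ?_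
  · exact (continuous_const.clm_comp
      (continuous_starProjection.clm_comp continuous_const)).continuousAt
  · exact ContinuousAt.comp (f := V.compr) (continuousAt_inverse h)
      V.continuous_compr.continuousAt

lemma continuous_graph (V : Gr k n) : Continuous V.graph := by
  refine continuous_induced_rng.2 ?_
  have : (fun W : Gr k n => W.1.starProjection) ∘ V.graph = fun A =>
      V.graphMap A ∘L Ring.inverse (adjoint (V.graphMap A) ∘L V.graphMap A) ∘L
        adjoint (V.graphMap A) := by
    funext A
    exact starProjection_range (V.graphMap_injective A)
  rw [this]
  have ha : Continuous fun A => adjoint (V.graphMap A) :=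
    (LinearIsometryEquiv.continuous _).comp V.continuous_graphMap
  refine V.continuous_graphMap.clm_comp (Continuous.clm_comp ?_ ha)
  refine continuous_iff_continuousAt.2 fun A => ?_
  exact ContinuousAt.comp (f := fun A => adjoint (V.graphMap A) ∘L V.graphMap A)
    (continuousAt_inverse (isUnit_gram (V.graphMap_injective A)))
    (ha.clm_comp V.continuous_graphMap).continuousAt

/-- The chart of the Grassmannian centred at `V`: it sends the graph of a linear map `V → Vᗮ` to
the expression of that map in orthonormal bases of `V` and `Vᗮ`. -/
def chart (V : Gr k n) : OpenPartialHomeomorph (Gr k n) (GrModel k n) where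
  toFun := V.slope
  invFun := V.graph
  source := {W | IsUnit (V.compr W)}
  target := Set.univ
  map_source' _ _ := trivial
  map_target' A _ := V.isUnit_compr_graph A
  left_inv' W h := V.graph_slope W h
  right_inv' A _ := V.slope_graph A
  open_source := Units.isOpen.preimage V.continuous_compr
  open_target := isOpen_univ
  continuousOn_toFun W h := (V.continuousAt_slope W h).continuousWithinAt
  continuousOn_invFun := V.continuous_graph.continuousOn

lemma mem_chart_source (V : Gr k n) : V ∈ V.chart.source := by
  change IsUnit (V.compr V)
  have : V.compr V = 1 := by
    rw [← V.e_e, compr]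
    congr 1
    ext1 x
    exact Submodule.starProjection_eq_self_iff.2 (V.e_mem x)
  rw [this]
  exact isUnit_one

instance : ChartedSpace (GrModel k n) (Gr k n) where
  atlas := Set.range chart
  chartAt := chart
  mem_chart_source := mem_chart_source
  chart_mem_atlas V := ⟨V, rfl⟩

lemma contDiffOn_transition (V V' : Gr k n) :
    ContDiffOn ℂ ω (V'.slope ∘ V.graph) {A | IsUnit (V'.compr (V.graph A))} := by
  have h (A) (hA : IsUnit (V'.compr (V.graph A))) :=
    V'.slope_range (V.graphMap_injective A) (V.graph A) rfl hA
  have hg : ContDiff ℂ ω V.graphMap := contDiff_const.add (contDiff_const.clm_comp contDiff_id)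
  refine ContDiffOn.congr
    (f := fun A => (adjoint V'.f ∘L V.graphMap A) ∘L
      Ring.inverse (adjoint V'.e ∘L V.graphMap A)) ?_ fun A hA => (h A hA).2
  intro A hA
  refine ContDiffAt.contDiffWithinAt ?_
  refine ContDiffAt.clm_comp (contDiff_const.clm_comp hg).contDiffAt ?_
  obtain ⟨u, hu⟩ := (h A hA).1
  have h0 := contDiffAt_ringInverse ℂ (n := ω) u
  rw [hu] at h0
  exact ContDiffAt.comp A (f := fun A => adjoint V'.e ∘L V.graphMap A) h0
    (contDiff_const.clm_comp hg).contDiffAt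

/-- The Grassmannian is a complex manifold. -/
instance : IsManifold 𝓘(ℂ, GrModel k n) ω (Gr k n) := by
  refine isManifold_of_contDiffOn _ _ _ ?_
  rintro _ _ ⟨V, rfl⟩ ⟨V', rfl⟩
  refine (contDiffOn_transition V V').mono ?_
  rintro A ⟨hA, -⟩
  exact hA.2

/-- The underlying smooth real manifold of the Grassmannian. -/
instance : IsManifold 𝓘(ℝ, GrModel k n) ∞ (Gr k n) := by
  refine isManifold_of_contDiffOn _ _ _ ?_
  rintro _ _ ⟨V, rfl⟩ ⟨V', rfl⟩
  refine (((contDiffOn_transition V V').restrict_scalars ℝ).of_le le_top).mono ?_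
  rintro A ⟨hA, -⟩
  exact hA.2

/-- The standard (Fubini-Study) inner product on `T_V Gr(k, ℂⁿ) = Hom(V, Vᗮ)`, namely
`2 Re tr(A* B)`. In Mathlib the tangent space at `V` is the model space, identified through the
chart centred at `V`, that is, through orthonormal bases of `V` and `Vᗮ`; the trace does not
depend on these bases. -/
def fubiniStudy (V : Gr k n) (A B : TangentSpace 𝓘(ℝ, GrModel k n) V) : ℝ :=
  2 * (LinearMap.trace ℂ (Cn k)
    (adjoint (show GrModel k n from A) ∘L (show GrModel k n from B) : Cn k →L[ℂ] Cn k)).re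

end Gr

/-! ### The adjoint orbit -/

/-- Complex `n × n` matrices, as operators on `ℂⁿ`. -/
abbrev Op (n : ℕ) := Cn n →L[ℂ] Cn n

/-- The form `⟨x, y⟩ = -tr(xy)`, which on `u(n)` is a (real-valued) inner product. -/
def uForm {n : ℕ} (x y : Op n) : ℂ := -LinearMap.trace ℂ (Cn n) (x ∘L y : Op n)

/-- The diagonal matrix `a` with eigenvalues `i/2` and `-i/2`, of multiplicities `k` and `n - k`. -/
def aMatrix (k n : ℕ) : Matrix (Fin n) (Fin n) ℂ :=
  Matrix.diagonal fun j => if (j : ℕ) < k then I / 2 else -(I / 2)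

/-- The adjoint `U(n)`-orbit of `a`; it is contained in the space `u(n)` of skew-Hermitian
matrices. -/
def adjointOrbit (k n : ℕ) : Set (Op n) :=
  {y | ∃ g ∈ Matrix.unitaryGroup (Fin n) ℂ,
    y = Matrix.toEuclideanCLM (𝕜 := ℂ) (g * aMatrix k n * g⁻¹)}

end

/-!
A subspace `V` is determined by the orthogonal projection `P` onto it, and everything is read off
from the map `proj : V ↦ P`, of which `theta = i P - i/2` is an affine image.

* In the chart centred at `V` the projection onto the graph of `A : V → Vᗮ` is a smooth function
  of `A`, and conversely `A` is a smooth function of the projection (`contDiff_proj_graph`,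
  `contDiffAt_slopeOf`). Hence a map into the Grassmannian is smooth iff its composition with
  `proj` is (`contMDiffWithinAt_iff_proj`).
* Linearising `P² = P`, `P* = P` shows that the differential of `proj` at `V` sends `A` to the
  off-diagonal operator `tangentOp V A` with blocks `A` and `A*` (`mfderiv_proj`). Therefore the
  standard metric is the pull-back of the trace form `Re tr(XY)`, which makes it smooth
  (`contMDiff_metricInner`) and compares it with `-tr(xy)` on the orbit (`metric_eq_uForm`).
* The reflection of `ℂⁿ` in `V` induces a holomorphic isometric involution of the Grassmannian,
  which is `A ↦ -A` in the chart at `V`. So the coefficients of the metric are even functions in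
  this chart (`metricCoeff_neg`) and their first derivatives vanish at its centre. Since the charts
  are holomorphic, the coefficients of the Kähler form are among those of the metric, so the form
  is closed; and the Christoffel symbols vanish at the centre of the chart.
* The Grassmannian is connected because any two chart domains, each an image of a vector space,
  meet (`exists_mem_source_inter`).
* Consequently the covariant acceleration of a curve is its second derivative in the chart centred
  at the point in question, which is the block `V → Vᗮ` of `P''` (`iteratedDeriv_two_slope`). The
  commutator of `theta` with `i P''` is off-diagonal with the same block `V → Vᗮ`, while the
  derivative of `theta` in `t` is off-diagonal with block `i u_t`; comparing these blocks identifies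
  the two forms of the equation (`gnlsAt_metric_iff`).
-/

noncomputable section

namespace Gr

variable {k n : ℕ}

/-! ### Operators in block form with respect to `V ⊕ Vᗮ` -/

lemma adjoint_e_e (V : Gr k n) (x) : adjoint V.e (V.e x) = x := DFunLike.congr_fun V.e_e x

lemma adjoint_f_f (V : Gr k n) (x) : adjoint V.f (V.f x) = x := DFunLike.congr_fun V.f_f x

lemma adjoint_e_f (V : Gr k n) (x) : adjoint V.e (V.f x) = 0 := DFunLike.congr_fun V.e_f x

lemma adjoint_f_e (V : Gr k n) (x) : adjoint V.f (V.e x) = 0 := DFunLike.congr_fun V.f_e x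

lemma e_add_f_apply (V : Gr k n) (x) : V.e (adjoint V.e x) + V.f (adjoint V.f x) = x :=
  DFunLike.congr_fun V.e_add_f x

/-- The orthogonal projection of `ℂⁿ` onto `V`. -/
def proj (V : Gr k n) : Op n := V.1.starProjection

lemma proj_e (V : Gr k n) (x) : V.proj (V.e x) = V.e x :=
  Submodule.starProjection_eq_self_iff.2 (V.e_mem x)

lemma proj_f (V : Gr k n) (x) : V.proj (V.f x) = 0 :=
  (Submodule.starProjection_apply_eq_zero_iff _).2 (V.f_mem x)

lemma proj_apply (V : Gr k n) (x) : V.proj x = V.e (adjoint V.e x) := by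
  conv_lhs => rw [← V.e_add_f_apply x, map_add, proj_e, proj_f, add_zero]

lemma proj_mul_proj (V : Gr k n) : V.proj * V.proj = V.proj :=
  V.1.isIdempotentElem_starProjection

lemma adjoint_proj (V : Gr k n) : adjoint V.proj = V.proj :=
  ContinuousLinearMap.isSelfAdjoint_iff'.1 (isSelfAdjoint_starProjection V.1)

lemma proj_eq_self_iff (V : Gr k n) {x} : V.proj x = x ↔ x ∈ V.1 :=
  Submodule.starProjection_eq_self_iff

lemma proj_injective : Function.Injective (proj : Gr k n → Op n) := fun V W h =>
  Subtype.ext (SetLike.ext fun x => by rw [← proj_eq_self_iff, ← proj_eq_self_iff, h])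

lemma isEmbedding_proj : Topology.IsEmbedding (proj : Gr k n → Op n) :=
  ⟨⟨rfl⟩, proj_injective⟩

/-- Two operators on `ℂⁿ` agree if their four blocks with respect to `V ⊕ Vᗮ` do. -/
lemma op_ext (V : Gr k n) {X Y : Op n}
    (hee : adjoint V.e ∘L X ∘L V.e = adjoint V.e ∘L Y ∘L V.e)
    (hef : adjoint V.e ∘L X ∘L V.f = adjoint V.e ∘L Y ∘L V.f)
    (hfe : adjoint V.f ∘L X ∘L V.e = adjoint V.f ∘L Y ∘L V.e)
    (hff : adjoint V.f ∘L X ∘L V.f = adjoint V.f ∘L Y ∘L V.f) : X = Y := by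
  have he (x) : X (V.e x) = Y (V.e x) := by
    rw [← V.e_add_f_apply (X (V.e x)), ← V.e_add_f_apply (Y (V.e x))]
    have h1 := DFunLike.congr_fun hee x
    have h2 := DFunLike.congr_fun hfe x
    simp only [ContinuousLinearMap.comp_apply] at h1 h2
    rw [h1, h2]
  have hf (x) : X (V.f x) = Y (V.f x) := by
    rw [← V.e_add_f_apply (X (V.f x)), ← V.e_add_f_apply (Y (V.f x))]
    have h1 := DFunLike.congr_fun hef x
    have h2 := DFunLike.congr_fun hff x
    simp only [ContinuousLinearMap.comp_apply] at h1 h2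
    rw [h1, h2]
  ext1 x
  rw [← V.e_add_f_apply x, map_add, map_add, he, hf]

/-- The element of `Hom(V, Vᗮ) ⊕ Hom(Vᗮ, V)` determined by `A : V → Vᗮ` and its adjoint; these
operators form the tangent space at `V` of the manifold of orthogonal projections. -/
def tangentOp (V : Gr k n) (A : Cn k →L[ℂ] Cn (n - k)) : Op n :=
  V.f ∘L A ∘L adjoint V.e + V.e ∘L adjoint A ∘L adjoint V.f

lemma tangentOp_apply (V : Gr k n) (A x) :
    V.tangentOp A x = V.f (A (adjoint V.e x)) + V.e (adjoint A (adjoint V.f x)) := rfl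

lemma f_tangentOp_e (V : Gr k n) (A) : adjoint V.f ∘L V.tangentOp A ∘L V.e = A := by
  ext1 x
  simp only [ContinuousLinearMap.comp_apply, tangentOp_apply, adjoint_e_e, adjoint_f_e, map_zero,
    add_zero, adjoint_f_f]

/-- A self-adjoint solution `X` of the linearised equation `X = X P + P X` of `P² = P` is
determined by its block `V → Vᗮ`. -/
lemma eq_tangentOp (V : Gr k n) {X : Op n} (hs : adjoint X = X)
    (hX : X * V.proj + V.proj * X = X) : X = V.tangentOp (adjoint V.f ∘L X ∘L V.e) := by
  have h (x) : X (V.proj x) + V.proj (X x) = X x := DFunLike.congr_fun hX x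
  have ha : adjoint (adjoint V.f ∘L X ∘L V.e) = adjoint V.e ∘L X ∘L V.f := by
    simp only [ContinuousLinearMap.adjoint_comp, ContinuousLinearMap.adjoint_adjoint, hs]
    rfl
  have he (x) : adjoint V.e (X (V.e x)) = 0 := by
    have := congrArg (adjoint V.e) (h (V.e x))
    rw [proj_e, proj_apply, map_add, adjoint_e_e] at this
    exact add_eq_left.1 this
  have hf (x) : adjoint V.f (X (V.f x)) = 0 := by
    have := congrArg (adjoint V.f) (h (V.f x))
    rw [proj_f, proj_apply, map_add, adjoint_f_e, map_zero, map_zero, zero_add] at this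
    exact this.symm
  rw [tangentOp, ha]
  apply V.op_ext <;> ext1 x <;>
    simp only [ContinuousLinearMap.comp_apply, add_apply, map_zero, adjoint_e_e,
      adjoint_e_f, adjoint_f_e, adjoint_f_f, he, hf, add_zero, zero_add]

/-! ### Smooth dependence of projection and slope on each other -/

/-- The chart at `V` as a function of the projection `Q` onto the subspace. -/
def slopeOf (V : Gr k n) (Q : Op n) : GrModel k n :=
  (show Cn k →L[ℂ] Cn (n - k) from
    (adjoint V.f ∘L Q ∘L V.e) ∘L Ring.inverse (adjoint V.e ∘L Q ∘L V.e))

lemma slopeOf_comp (V : Gr k n) {Q : Op n} (h : IsUnit (adjoint V.e ∘L Q ∘L V.e)) :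
    (show Cn k →L[ℂ] Cn (n - k) from V.slopeOf Q) ∘L (adjoint V.e ∘L Q ∘L V.e)
      = adjoint V.f ∘L Q ∘L V.e := by
  have := Ring.inverse_mul_cancel _ h
  ext1 x
  exact congrArg (adjoint V.f ∘L Q ∘L V.e) (DFunLike.congr_fun this x)

/-- Taking adjoints, as a real-linear map. -/
def adjointL (p q : ℕ) : (Cn p →L[ℂ] Cn q) →L[ℝ] (Cn q →L[ℂ] Cn p) where
  toFun X := adjoint X
  map_add' X Y := map_add _ X Y
  map_smul' r X := by
    have := (adjoint : (Cn p →L[ℂ] Cn q) ≃ₗᵢ⋆[ℂ] (Cn q →L[ℂ] Cn p)).map_smulₛₗ (r : ℂ) X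
    simpa using this
  cont := (adjoint : (Cn p →L[ℂ] Cn q) ≃ₗᵢ⋆[ℂ] (Cn q →L[ℂ] Cn p)).continuous

lemma contDiffAt_slopeOf (V : Gr k n) {Q : Op n} (h : IsUnit (adjoint V.e ∘L Q ∘L V.e))
    {m : WithTop ℕ∞} : ContDiffAt ℂ m V.slopeOf Q := by
  have h1 : ContDiff ℂ m fun Q : Op n => adjoint V.f ∘L Q ∘L V.e :=
    contDiff_const.clm_comp (contDiff_id.clm_comp contDiff_const)
  have h2 : ContDiff ℂ m fun Q : Op n => adjoint V.e ∘L Q ∘L V.e :=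
    contDiff_const.clm_comp (contDiff_id.clm_comp contDiff_const)
  refine ContDiffAt.clm_comp (g := fun Q : Op n => adjoint V.f ∘L Q ∘L V.e)
    (f := fun Q : Op n => Ring.inverse (adjoint V.e ∘L Q ∘L V.e)) h1.contDiffAt ?_
  obtain ⟨u, hu⟩ := h
  have h0 := contDiffAt_ringInverse ℂ (n := m) u
  rw [hu] at h0
  exact ContDiffAt.comp Q (f := fun Q => adjoint V.e ∘L Q ∘L V.e) h0 h2.contDiffAt

lemma contDiff_comp_real {E : Type*} [NormedAddCommGroup E] [NormedSpace ℝ E] {p q r : ℕ}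
    {m : WithTop ℕ∞} {X : E → Cn q →L[ℂ] Cn r} {Y : E → Cn p →L[ℂ] Cn q}
    (hX : ContDiff ℝ m X) (hY : ContDiff ℝ m Y) : ContDiff ℝ m fun z => X z ∘L Y z := by
  have h : ContDiff ℂ m fun z : (Cn q →L[ℂ] Cn r) × (Cn p →L[ℂ] Cn q) => z.1 ∘L z.2 :=
    contDiff_fst.clm_comp contDiff_snd
  exact (h.restrict_scalars ℝ).comp (hX.prodMk hY)

lemma contDiff_graphMap (V : Gr k n) {m : WithTop ℕ∞} :
    ContDiff ℂ m (fun A : GrModel k n => V.graphMap A) :=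
  contDiff_const.add (contDiff_const.clm_comp contDiff_id)

lemma contDiff_proj_graph (V : Gr k n) {m : WithTop ℕ∞} :
    ContDiff ℝ m (fun A : GrModel k n => (V.graph A).proj) := by
  have : (fun A : GrModel k n => (V.graph A).proj) = fun A =>
      V.graphMap A ∘L Ring.inverse (adjoint (V.graphMap A) ∘L V.graphMap A) ∘L
        adjoint (V.graphMap A) := by
    funext A
    exact starProjection_range (V.graphMap_injective A)
  rw [this]
  have hg : ContDiff ℝ m (fun A : GrModel k n => V.graphMap A) :=
    V.contDiff_graphMap.restrict_scalars ℝ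
  have ha : ContDiff ℝ m (fun A : GrModel k n => adjoint (V.graphMap A)) :=
    (adjointL k n).contDiff.comp hg
  refine contDiff_comp_real hg (contDiff_comp_real (contDiff_iff_contDiffAt.2 fun A => ?_) ha)
  obtain ⟨u, hu⟩ := isUnit_gram (V.graphMap_injective A)
  have h0 := (contDiffAt_ringInverse ℂ (n := m) u).restrict_scalars ℝ
  rw [hu] at h0
  exact ContDiffAt.comp A (f := fun A : GrModel k n => adjoint (V.graphMap A) ∘L V.graphMap A) h0
    (contDiff_comp_real ha hg).contDiffAt

lemma graph_zero (V : Gr k n) : V.graph 0 = V := by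
  have h := V.mem_chart_source
  have h1 : V.slope V = 0 := by
    have : (adjoint V.f ∘L V.1.starProjection ∘L V.e) = 0 := by
      ext1 x
      change adjoint V.f (V.proj (V.e x)) = 0
      rw [proj_e, adjoint_f_e]
    rw [slope, this, ContinuousLinearMap.zero_comp]
  rw [← h1]
  exact V.graph_slope V h

lemma slope_self (V : Gr k n) : V.slope V = 0 := by
  have h := V.slope_graph 0
  rwa [graph_zero] at h

/-! ### Curves of projections -/

lemma hasDerivAt_comp_real {p q r : ℕ} {X : ℝ → Cn q →L[ℂ] Cn r} {Y : ℝ → Cn p →L[ℂ] Cn q}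
    {X' : Cn q →L[ℂ] Cn r} {Y' : Cn p →L[ℂ] Cn q} {s : ℝ}
    (hX : HasDerivAt X X' s) (hY : HasDerivAt Y Y' s) :
    HasDerivAt (fun z => X z ∘L Y z) (X' ∘L Y s + X s ∘L Y') s := by
  let B := (ContinuousLinearMap.compL ℂ (Cn p) (Cn q) (Cn r)).bilinearRestrictScalars ℝ
  have := B.hasDerivAt_of_bilinear (fun _ => hX) (fun _ => hY)
  rw [add_comm]
  exact this

lemma hasDerivAt_adjoint {p q : ℕ} {X : ℝ → Cn p →L[ℂ] Cn q} {X' : Cn p →L[ℂ] Cn q} {s : ℝ}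
    (hX : HasDerivAt X X' s) : HasDerivAt (fun z => adjoint (X z)) (adjoint X') s :=
  (adjointL p q).hasFDerivAt.comp_hasDerivAt s hX

/-- The velocity of a curve of projections is tangent to the manifold of projections. -/
lemma eq_tangentOp_of_hasDerivAt {c : ℝ → Gr k n} {s : ℝ} {P' : Op n}
    (h : HasDerivAt (fun r => (c r).proj) P' s) :
    P' = (c s).tangentOp (adjoint (c s).f ∘L P' ∘L (c s).e) := by
  refine (c s).eq_tangentOp ?_ ?_
  · have h1 := hasDerivAt_adjoint h
    simp only [adjoint_proj] at h1
    exact h1.unique h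
  · have h1 : HasDerivAt (fun r => (c r).proj * (c r).proj) _ s := hasDerivAt_comp_real h h
    simp only [proj_mul_proj] at h1
    exact h1.unique h

lemma hasDerivAt_block {p q : ℕ} (a : Cn n →L[ℂ] Cn q) (b : Cn p →L[ℂ] Cn n) {P : ℝ → Op n}
    {P' : Op n} {s : ℝ} (h : HasDerivAt P P' s) :
    HasDerivAt (fun r => a ∘L P r ∘L b) (a ∘L P' ∘L b) s := by
  simpa using hasDerivAt_comp_real (hasDerivAt_const s a)
    (hasDerivAt_comp_real h (hasDerivAt_const s b))

lemma e_tangentOp_e (V : Gr k n) (A) : adjoint V.e ∘L V.tangentOp A ∘L V.e = 0 := by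
  ext1 x
  simp only [ContinuousLinearMap.comp_apply, tangentOp_apply, adjoint_e_f, adjoint_f_e, map_zero,
    add_zero, zero_apply]

lemma e_proj_e (V : Gr k n) : adjoint V.e ∘L V.proj ∘L V.e = 1 := by
  ext1 x
  simp only [ContinuousLinearMap.comp_apply, proj_e, adjoint_e_e, one_apply_eq_self]

lemma contDiffAt_slope_comp {E : Type*} [NormedAddCommGroup E] [NormedSpace ℝ E] (V : Gr k n)
    {c : E → Gr k n} {z : E} {m : WithTop ℕ∞} (hc : ContDiffAt ℝ m (fun y => (c y).proj) z)
    (hu : IsUnit (V.compr (c z))) : ContDiffAt ℝ m (fun y => (V.slope (c y) : GrModel k n)) z :=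
  ContDiffAt.comp z (g := V.slopeOf) (f := fun y => (c y).proj)
    ((V.contDiffAt_slopeOf hu).restrict_scalars ℝ) hc

lemma isUnit_compr_self (V : Gr k n) : IsUnit (V.compr V) := V.mem_chart_source

lemma eventually_isUnit_compr {E : Type*} [NormedAddCommGroup E] [NormedSpace ℝ E] (V : Gr k n)
    {c : E → Gr k n} {z : E} (hc : ContinuousAt (fun y => (c y).proj) z)
    (hu : IsUnit (V.compr (c z))) : ∀ᶠ y in nhds z, IsUnit (V.compr (c y)) :=
  (isEmbedding_proj.isInducing.continuousAt_iff.2 hc).eventually (V.chart.open_source.mem_nhds hu)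

/-- The velocity of a curve in the chart at one of its points. -/
lemma hasDerivAt_slope {c : ℝ → Gr k n} {s : ℝ} {P' : Op n}
    (h : HasDerivAt (fun r => (c r).proj) P' s) :
    HasDerivAt (fun r => ((c s).slope (c r) : GrModel k n))
      (adjoint (c s).f ∘L P' ∘L (c s).e) s := by
  set V := c s with hV
  have hu : IsUnit (V.compr (c s)) := V.isUnit_compr_self
  have hd : DifferentiableAt ℝ (fun r => (V.slope (c r) : GrModel k n)) s :=
    DifferentiableAt.comp s (g := V.slopeOf) (f := fun r => (c r).proj)
      (((V.contDiffAt_slopeOf (m := 1) hu).restrict_scalars ℝ).differentiableAt one_ne_zero)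
      h.differentiableAt
  have h1 := hasDerivAt_comp_real hd.hasDerivAt (hasDerivAt_block (adjoint V.e) V.e h)
  have h2 := hasDerivAt_block (adjoint V.f) V.e h
  have h3 := h1.unique (h2.congr_of_eventuallyEq ?_)
  · rw [← hV, slope_self, ContinuousLinearMap.zero_comp, add_zero, e_proj_e] at h3
    have h4 : deriv (fun r => (V.slope (c r) : GrModel k n)) s = adjoint V.f ∘L P' ∘L V.e := h3
    rw [← h4]
    exact hd.hasDerivAt
  · filter_upwards [V.eventually_isUnit_compr h.continuousAt hu] with r hr
    exact V.slopeOf_comp hr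

/-- The acceleration of a curve in the chart at one of its points. There are no correction terms
because the chart vanishes at its centre and the velocity has no diagonal blocks. -/
lemma iteratedDeriv_two_slope {c : ℝ → Gr k n} {s : ℝ}
    (h : ContDiffAt ℝ 2 (fun r => (c r).proj) s) :
    iteratedDeriv 2 (fun r => ((c s).slope (c r) : GrModel k n)) s =
      adjoint (c s).f ∘L iteratedDeriv 2 (fun r => (c r).proj) s ∘L (c s).e := by
  set V := c s with hV
  set P : ℝ → Op n := fun r => (c r).proj with hP
  set u : ℝ → GrModel k n := fun r => V.slope (c r) with hu'
  have hu : IsUnit (V.compr (c s)) := V.isUnit_compr_self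
  have hc : ContDiffAt ℝ 2 u s := V.contDiffAt_slope_comp h hu
  have h1P : ∀ᶠ r in nhds s, HasDerivAt P (deriv P r) r := 
    ((h.eventually (by simp)).mono fun r hr => (hr.differentiableAt two_ne_zero).hasDerivAt)
  have h1u : ∀ᶠ r in nhds s, HasDerivAt u (deriv u r) r := 
    ((hc.eventually (by simp)).mono fun r hr => (hr.differentiableAt two_ne_zero).hasDerivAt)
  have h2P : HasDerivAt (deriv P) (iteratedDeriv 2 P s) s := by
    rw [iteratedDeriv_succ, iteratedDeriv_one]
    exact ((h.derivWithin (m := 1) le_rfl).differentiableAt one_ne_zero).hasDerivAt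
  have h2u : HasDerivAt (deriv u) (iteratedDeriv 2 u s) s := by
    rw [iteratedDeriv_succ, iteratedDeriv_one]
    exact ((hc.derivWithin (m := 1) le_rfl).differentiableAt one_ne_zero).hasDerivAt
  -- The slope satisfies `u (e* P e) = f* P e`; differentiate this identity near `s`.
  have hF : (fun r => deriv u r ∘L (adjoint V.e ∘L P r ∘L V.e) +
      u r ∘L (adjoint V.e ∘L deriv P r ∘L V.e)) =ᶠ[nhds s]
        fun r => adjoint V.f ∘L deriv P r ∘L V.e := by
    filter_upwards [h1P, h1u, (V.eventually_isUnit_compr h.continuousAt hu).eventually_nhds]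
      with r hP hu hr
    refine (hasDerivAt_comp_real hu (hasDerivAt_block (adjoint V.e) V.e hP)).unique
      ((hasDerivAt_block (adjoint V.f) V.e hP).congr_of_eventuallyEq ?_)
    filter_upwards [hr] with r' hr'
    exact V.slopeOf_comp hr'
  -- Differentiate once more; at `s` one has `u = 0`, `e* P' e = 0` and `e* P e = 1`.
  have h4 := ((hasDerivAt_comp_real h2u (hasDerivAt_block (adjoint V.e) V.e h1P.self_of_nhds)).add
    (hasDerivAt_comp_real h1u.self_of_nhds (hasDerivAt_block (adjoint V.e) V.e h2P))).unique
      ((hasDerivAt_block (adjoint V.f) V.e h2P).congr_of_eventuallyEq hF)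
  have h5 : adjoint V.e ∘L deriv P s ∘L V.e = 0 := by
    rw [eq_tangentOp_of_hasDerivAt h1P.self_of_nhds, e_tangentOp_e]
  have h6 : u s = 0 := V.slope_self
  have h7 : adjoint V.e ∘L P s ∘L V.e = 1 := V.e_proj_e
  rw [h5, h6, h7] at h4
  have key (S T U : Cn k →L[ℂ] Cn (n - k)) (X : Cn k →L[ℂ] Cn k)
      (h : S ∘L 1 + T ∘L 0 + (T ∘L 0 + 0 ∘L X) = U) : S = U := by
    rw [← h]
    ext1 x
    simp
  exact key _ _ _ _ h4

/-- The derivative at its centre of the inverse of the chart at `V`, followed by `proj`. -/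
lemma fderiv_proj_graph (V : Gr k n) (A : GrModel k n) :
    fderiv ℝ (fun A : GrModel k n => (V.graph A).proj) 0 A = V.tangentOp A := by
  have hd := (V.contDiff_proj_graph (m := 1)).differentiable one_ne_zero 0
  have h0 : HasDerivAt (fun t : ℝ => t • A) A 0 := by
    simpa using (hasDerivAt_id (0 : ℝ)).smul_const A
  have h1 : HasDerivAt (fun t : ℝ => (V.graph (t • A)).proj)
      (fderiv ℝ (fun A : GrModel k n => (V.graph A).proj) 0 A) 0 := by
    refine HasFDerivAt.comp_hasDerivAt (0 : ℝ) (l := fun A : GrModel k n => (V.graph A).proj) ?_ h0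
    rw [zero_smul]
    exact hd.hasFDerivAt
  have hc : V.graph ((0 : ℝ) • A) = V := by rw [zero_smul]; exact V.graph_zero
  have h2 := eq_tangentOp_of_hasDerivAt (c := fun t : ℝ => V.graph (t • A)) h1
  have h3 := hasDerivAt_slope (c := fun t : ℝ => V.graph (t • A)) h1
  simp only [hc] at h2 h3
  have h4 : (fun t : ℝ => (V.slope (V.graph (t • A)) : GrModel k n)) = fun t => t • A :=
    funext fun t => V.slope_graph _
  rw [h4] at h3
  rw [h2, h3.unique h0]

/-! ### The commutator equation in blocks -/

lemma e_tangentOp_f (V : Gr k n) (A) : adjoint V.e ∘L V.tangentOp A ∘L V.f = adjoint A := by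
  ext1 x
  simp only [ContinuousLinearMap.comp_apply, tangentOp_apply, adjoint_e_f, adjoint_e_e, map_zero,
    zero_add, adjoint_f_f]

lemma f_tangentOp_f (V : Gr k n) (A) : adjoint V.f ∘L V.tangentOp A ∘L V.f = 0 := by
  ext1 x
  simp only [ContinuousLinearMap.comp_apply, tangentOp_apply, adjoint_e_f, map_zero, zero_add,
    adjoint_f_e, zero_apply]

lemma adjoint_e_proj (V : Gr k n) (x) : adjoint V.e (V.proj x) = adjoint V.e x := by
  rw [proj_apply, adjoint_e_e]

lemma adjoint_f_proj (V : Gr k n) (x) : adjoint V.f (V.proj x) = 0 := by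
  rw [proj_apply, adjoint_f_e]

/-- Commutation with the projection onto `V` kills the diagonal blocks of `Y` and changes the sign
of the block `Vᗮ → V`; hence the equation amounts to one between blocks `V → Vᗮ`. -/
lemma smul_tangentOp_eq_commutator_iff (V : Gr k n) (A : Cn k →L[ℂ] Cn (n - k)) {Y : Op n}
    (hY : adjoint Y = Y) :
    I • V.tangentOp A = Y * V.proj - V.proj * Y ↔ I • A = adjoint V.f ∘L Y ∘L V.e := by
  have hfe : adjoint V.f ∘L (Y * V.proj - V.proj * Y) ∘L V.e = adjoint V.f ∘L Y ∘L V.e := by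
    ext1 x
    simp only [ContinuousLinearMap.comp_apply, sub_apply, mul_apply_eq_comp, map_sub, proj_e,
      adjoint_f_proj, sub_zero]
  have hsm {p q : ℕ} (a : Cn n →L[ℂ] Cn q) (b : Cn p →L[ℂ] Cn n) (X : Op n) :
      a ∘L (I • X) ∘L b = I • (a ∘L X ∘L b) := by
    rw [ContinuousLinearMap.smul_comp, ContinuousLinearMap.comp_smul]
  constructor
  · intro h
    rw [← hfe, ← h, hsm, f_tangentOp_e]
  · intro h
    have h' : adjoint V.e ∘L Y ∘L V.f = -(I • adjoint A) := by
      have := congrArg adjoint h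
      simp only [ContinuousLinearMap.adjoint_comp, ContinuousLinearMap.adjoint_adjoint, hY,
        map_smulₛₗ, Complex.conj_I, neg_smul] at this
      exact this.symm
    refine V.op_ext ?_ ?_ ?_ ?_
    · rw [hsm, e_tangentOp_e]
      ext1 x
      simp only [smul_apply, zero_apply, smul_zero, ContinuousLinearMap.comp_apply,
        sub_apply, mul_apply_eq_comp, map_sub, proj_e,
        adjoint_e_proj, sub_self, zero_apply]
    · rw [hsm, e_tangentOp_f, ← neg_inj, ← h']
      ext1 x
      simp only [ContinuousLinearMap.comp_apply, sub_apply, mul_apply_eq_comp, proj_f,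
        adjoint_e_proj, map_zero, zero_sub, neg_neg, neg_apply, map_neg]
    · rw [hfe, hsm, f_tangentOp_e, h]
    · rw [hsm, f_tangentOp_f]
      ext1 x
      simp only [smul_apply, zero_apply, smul_zero, ContinuousLinearMap.comp_apply,
        sub_apply, mul_apply_eq_comp, map_sub, proj_f,
        adjoint_f_proj, map_zero, sub_self, zero_apply]

/-! ### The trace form -/

/-- The trace of a continuous operator. -/
abbrev opTrace {p : ℕ} (X : Cn p →L[ℂ] Cn p) : ℂ := LinearMap.trace ℂ (Cn p) X

lemma opTrace_comp_comm {p q : ℕ} (X : Cn p →L[ℂ] Cn q) (Y : Cn q →L[ℂ] Cn p) :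
    opTrace (X ∘L Y) = opTrace (Y ∘L X) :=
  LinearMap.trace_comp_comm' _ _

lemma opTrace_adjoint {p : ℕ} (X : Cn p →L[ℂ] Cn p) :
    opTrace (adjoint X) = starRingEnd ℂ (opTrace X) := by
  rw [opTrace, opTrace, LinearMap.trace_eq_sum_inner _ (EuclideanSpace.basisFun (Fin p) ℂ),
    LinearMap.trace_eq_sum_inner _ (EuclideanSpace.basisFun (Fin p) ℂ), map_sum]
  refine Finset.sum_congr rfl fun i _ => ?_
  rw [inner_conj_symm]
  exact ContinuousLinearMap.adjoint_inner_right _ _ _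

/-- The trace `tr(A* A)` is the sum of the squares of the norms of the columns of `A`. -/
lemma opTrace_adjoint_comp_self {p q : ℕ} (A : Cn p →L[ℂ] Cn q) :
    (opTrace (adjoint A ∘L A)).re = ∑ i, ‖A (EuclideanSpace.basisFun (Fin p) ℂ i)‖ ^ 2 := by
  rw [opTrace, LinearMap.trace_eq_sum_inner _ (EuclideanSpace.basisFun (Fin p) ℂ), Complex.re_sum]
  refine Finset.sum_congr rfl fun i _ => ?_
  change (⟪_, adjoint A (A _)⟫_ℂ).re = _
  rw [ContinuousLinearMap.adjoint_inner_right]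
  exact (norm_sq_eq_re_inner (𝕜 := ℂ) _).symm

/-- The operator norm is at most the Frobenius norm. -/
lemma sq_opNorm_le_opTrace {p q : ℕ} (A : Cn p →L[ℂ] Cn q) :
    ‖A‖ ^ 2 ≤ (opTrace (adjoint A ∘L A)).re := by
  set S := (opTrace (adjoint A ∘L A)).re with hS
  have hS' := opTrace_adjoint_comp_self A
  have h0 : 0 ≤ S := by rw [hS, hS']; positivity
  suffices ‖A‖ ≤ √S by
    calc ‖A‖ ^ 2 ≤ √S ^ 2 := by gcongr
      _ = S := Real.sq_sqrt h0
  refine A.opNorm_le_bound (Real.sqrt_nonneg _) fun x => ?_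
  have hx : A x = ∑ i, x i • A (EuclideanSpace.basisFun (Fin p) ℂ i) := by
    conv_lhs => rw [← (EuclideanSpace.basisFun (Fin p) ℂ).sum_repr x]
    simp only [map_sum, map_smul, EuclideanSpace.basisFun_repr]
  calc ‖A x‖ ≤ ∑ i, ‖x i‖ * ‖A (EuclideanSpace.basisFun (Fin p) ℂ i)‖ := by
        rw [hx]
        exact (norm_sum_le _ _).trans_eq (by simp only [norm_smul])
    _ ≤ √(∑ i, ‖x i‖ ^ 2) * √(∑ i, ‖A (EuclideanSpace.basisFun (Fin p) ℂ i)‖ ^ 2) :=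
        Real.sum_mul_le_sqrt_mul_sqrt _ _ _
    _ = √S * ‖x‖ := by rw [← hS', ← hS, EuclideanSpace.norm_eq, mul_comm]

lemma opTrace_tangentOp_mul (V : Gr k n) (A B : Cn k →L[ℂ] Cn (n - k)) :
    opTrace (V.tangentOp A ∘L V.tangentOp B) = (2 * (opTrace (adjoint A ∘L B)).re : ℝ) := by
  have h : V.tangentOp A ∘L V.tangentOp B =
      V.f ∘L (A ∘L adjoint B ∘L adjoint V.f) + V.e ∘L (adjoint A ∘L B ∘L adjoint V.e) := by
    ext1 x
    simp only [ContinuousLinearMap.comp_apply, tangentOp_apply, map_add, adjoint_e_e, adjoint_f_f,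
      adjoint_e_f, adjoint_f_e, map_zero, zero_add, add_zero, add_apply]
    exact add_comm _ _
  have h1 : opTrace (V.f ∘L (A ∘L adjoint B ∘L adjoint V.f)) = opTrace (adjoint B ∘L A) := by
    have : (A ∘L adjoint B ∘L adjoint V.f) ∘L V.f = A ∘L adjoint B := by
      ext1 x
      simp only [ContinuousLinearMap.comp_apply, adjoint_f_f]
    rw [opTrace_comp_comm, opTrace_comp_comm (adjoint B), this]
  have h2 : opTrace (V.e ∘L (adjoint A ∘L B ∘L adjoint V.e)) = opTrace (adjoint A ∘L B) := by
    have : (adjoint A ∘L B ∘L adjoint V.e) ∘L V.e = adjoint A ∘L B := by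
      ext1 x
      simp only [ContinuousLinearMap.comp_apply, adjoint_e_e]
    rw [opTrace_comp_comm, this]
  have h3 : adjoint B ∘L A = adjoint (adjoint A ∘L B) := by
    rw [ContinuousLinearMap.adjoint_comp, ContinuousLinearMap.adjoint_adjoint]
  rw [h, opTrace, ContinuousLinearMap.toLinearMap_add, map_add]
  change opTrace _ + opTrace _ = _
  rw [h1, h2, h3, opTrace_adjoint, add_comm, Complex.add_conj]

/-! ### The Grassmannian as a submanifold of the space of operators -/

lemma contMDiff_proj {m : WithTop ℕ∞} :
    ContMDiff 𝓘(ℝ, GrModel k n) 𝓘(ℝ, Op n) m (proj : Gr k n → Op n) := fun V =>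
  contMDiffAt_iff.2 ⟨isEmbedding_proj.continuous.continuousAt,
    V.contDiff_proj_graph.contDiffAt.contDiffWithinAt⟩

lemma mfderiv_proj (V : Gr k n) (A : GrModel k n) :
    mfderiv 𝓘(ℝ, GrModel k n) 𝓘(ℝ, Op n) proj V A = V.tangentOp A := by
  rw [← fderiv_proj_graph]
  rw [((contMDiff_proj (m := 1)).mdifferentiable one_ne_zero V).mfderiv, writtenInExtChartAt]
  have h : extChartAt 𝓘(ℝ, GrModel k n) V V = 0 := V.slope_self
  rw [h, modelWithCornersSelf_coe, Set.range_id, fderivWithin_univ]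
  rfl

/-- A map into the Grassmannian is smooth iff the projections onto its values depend smoothly on
the point. -/
lemma contMDiffWithinAt_iff_proj {E' H' M' : Type*} [NormedAddCommGroup E'] [NormedSpace ℝ E']
    [TopologicalSpace H'] {J : ModelWithCorners ℝ E' H'} [TopologicalSpace M'] [ChartedSpace H' M']
    {γ : M' → Gr k n} {s : Set M'} {z : M'} {m : ℕ∞} :
    ContMDiffWithinAt J 𝓘(ℝ, GrModel k n) m γ s z ↔
      ContMDiffWithinAt J 𝓘(ℝ, Op n) m (fun y => (γ y).proj) s z := by
  constructor
  · intro h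
    exact (contMDiff_proj.contMDiffAt (x := γ z)).comp_contMDiffWithinAt z h
  · intro h
    rw [contMDiffWithinAt_iff_target]
    refine ⟨isEmbedding_proj.isInducing.continuousWithinAt_iff.2 h.continuousWithinAt, ?_⟩
    have h1 := ((γ z).contDiffAt_slopeOf (m := m) (γ z).isUnit_compr_self).restrict_scalars ℝ
    exact ContMDiffAt.comp_contMDiffWithinAt z (g := (γ z).slopeOf) h1.contMDiffAt h

instance : T2Space (Gr k n) := isEmbedding_proj.t2Space

instance : SecondCountableTopology (Gr k n) := isEmbedding_proj.secondCountableTopology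

/-! ### The standard metric -/

/-- The trace, as a continuous linear form. -/
def traceL (n : ℕ) : Op n →L[ℂ] ℂ :=
  LinearMap.toContinuousLinearMap (LinearMap.trace ℂ (Cn n) ∘ₗ ContinuousLinearMap.coeLM ℂ)

/-- The real trace form `(X, Y) ↦ Re tr(X Y)`. -/
def traceForm (n : ℕ) : Op n →L[ℝ] Op n →L[ℝ] ℝ :=
  (ContinuousLinearMap.compL ℝ (Op n) (Op n) ℝ
    (Complex.reCLM ∘L (traceL n).restrictScalars ℝ)) ∘L
      (ContinuousLinearMap.compL ℂ (Cn n) (Cn n) (Cn n)).bilinearRestrictScalars ℝ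

/-- The differential of `proj` at `V`. -/
def dproj (V : Gr k n) : GrModel k n →L[ℝ] Op n :=
  mfderiv 𝓘(ℝ, GrModel k n) 𝓘(ℝ, Op n) proj V

lemma dproj_apply (V : Gr k n) (A : GrModel k n) : V.dproj A = V.tangentOp A := V.mfderiv_proj A

/-- The pull-back of the trace form under `proj`. -/
def metricInner (V : Gr k n) : TangentSpace 𝓘(ℝ, GrModel k n) V →L[ℝ]
    TangentSpace 𝓘(ℝ, GrModel k n) V →L[ℝ] ℝ :=
  (traceForm n).bilinearComp V.dproj V.dproj

lemma metricInner_apply (V : Gr k n) (A B : TangentSpace 𝓘(ℝ, GrModel k n) V) :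
    V.metricInner A B = V.fubiniStudy A B := by
  change traceForm n (V.dproj (show GrModel k n from A)) (V.dproj (show GrModel k n from B)) = _
  rw [dproj_apply, dproj_apply]
  exact (congrArg Complex.re (V.opTrace_tangentOp_mul A B)).trans (Complex.ofReal_re _)

lemma contDiff_bilinearComp {E F G : Type*} [NormedAddCommGroup E] [NormedSpace ℝ E]
    [NormedAddCommGroup F] [NormedSpace ℝ F] [NormedAddCommGroup G] [NormedSpace ℝ G]
    (B : F →L[ℝ] F →L[ℝ] G) {m : WithTop ℕ∞} :
    ContDiff ℝ m fun L : E →L[ℝ] F => B.bilinearComp L L := by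
  have h1 : ContDiff ℝ m (ContinuousLinearMap.flipₗᵢ ℝ E F G) := LinearIsometryEquiv.contDiff _
  have h2 : ContDiff ℝ m (ContinuousLinearMap.flipₗᵢ ℝ E E G) := LinearIsometryEquiv.contDiff _
  exact h2.comp ((h1.comp (contDiff_const.clm_comp contDiff_id)).clm_comp contDiff_id)

lemma contMDiff_metricInner : ContMDiff 𝓘(ℝ, GrModel k n)
    (𝓘(ℝ, GrModel k n).prod 𝓘(ℝ, GrModel k n →L[ℝ] GrModel k n →L[ℝ] ℝ)) ∞
    (fun V : Gr k n ↦ Bundle.TotalSpace.mk' (GrModel k n →L[ℝ] GrModel k n →L[ℝ] ℝ)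
      (E := fun V => TangentSpace 𝓘(ℝ, GrModel k n) V →L[ℝ]
        TangentSpace 𝓘(ℝ, GrModel k n) V →L[ℝ] ℝ)
      V V.metricInner) := by
  intro V
  have h := (contMDiff_proj (k := k) (n := n) (m := ∞)).contMDiffAt (x := V).mfderiv_const
    (m := ∞) (by simp)
  rw [contMDiffAt_hom_bundle]
  refine ⟨contMDiffAt_id, ?_⟩
  have h2 : ContMDiffAt 𝓘(ℝ, GrModel k n) 𝓘(ℝ, GrModel k n →L[ℝ] GrModel k n →L[ℝ] ℝ) ∞
      (fun W => (traceForm n).bilinearComp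
        (inTangentCoordinates 𝓘(ℝ, GrModel k n) 𝓘(ℝ, Op n) id proj
          (mfderiv 𝓘(ℝ, GrModel k n) 𝓘(ℝ, Op n) proj) V W)
        (inTangentCoordinates 𝓘(ℝ, GrModel k n) 𝓘(ℝ, Op n) id proj
          (mfderiv 𝓘(ℝ, GrModel k n) 𝓘(ℝ, Op n) proj) V W)) V := by
    have h3 : ContDiff ℝ ∞ fun L : GrModel k n →L[ℝ] Op n => (traceForm n).bilinearComp L L := by
      exact contDiff_bilinearComp _
    exact h3.contMDiff.contMDiffAt.comp V h
  refine h2.congr_of_eventuallyEq ?_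
  filter_upwards [V.chart.open_source.mem_nhds V.mem_chart_source] with W hW
  ext A B
  have hb : W ∈ (trivializationAt (GrModel k n) (TangentSpace 𝓘(ℝ, GrModel k n)) V).baseSet := hW
  -- In the trivialisation at `V` the metric is the pull-back of the constant trace form under the
  -- coordinate expression of the differential of `proj`, which is smooth.
  have h4 (A : GrModel k n) : inTangentCoordinates 𝓘(ℝ, GrModel k n) 𝓘(ℝ, Op n) id proj
      (mfderiv 𝓘(ℝ, GrModel k n) 𝓘(ℝ, Op n) proj) V W A = W.dproj
        ((trivializationAt (GrModel k n) (TangentSpace 𝓘(ℝ, GrModel k n)) V).symm W A) := by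
    have h5 := DFunLike.congr_fun
      (TangentBundle.continuousLinearMapAt_model_space (𝕜 := ℝ) V.proj W.proj)
      (W.dproj ((trivializationAt (GrModel k n) (TangentSpace 𝓘(ℝ, GrModel k n)) V).symm W A))
    rw [← Bundle.Trivialization.symmL_apply (R := ℝ) _ hb] at h5 ⊢
    exact h5
  refine (inCoordinates_apply_eq₂ (E₃ := Bundle.Trivial (Gr k n) ℝ) (F₃ := ℝ) hb hb
    (Set.mem_univ _)).trans ?_
  rw [ContinuousLinearMap.bilinearComp_apply]
  refine Eq.trans ?_ (congrArg₂ (fun X Y => traceForm n X Y) (h4 A) (h4 B)).symm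
  exact DFunLike.congr_fun (Bundle.Trivial.linearMapAt_trivialization ℝ (Gr k n) ℝ W) _

/-- The standard metric of the Grassmannian. -/
def metric (k n : ℕ) : RiemMetric (GrModel k n) (Gr k n) where
  inner V := V.metricInner
  symm V A B := show (opTrace (V.dproj A ∘L V.dproj B)).re = (opTrace (V.dproj B ∘L V.dproj A)).re
    from congrArg Complex.re (opTrace_comp_comm _ _)
  pos V A hA := by
    rw [metricInner_apply]
    have h1 := sq_opNorm_le_opTrace (show Cn k →L[ℂ] Cn (n - k) from A)
    have h2 : 0 < ‖(show GrModel k n from A)‖ := norm_pos_iff.2 hA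
    have h3 : 0 < ‖(show GrModel k n from A)‖ ^ 2 := by positivity
    exact mul_pos two_pos (h3.trans_le h1)
  isVonNBounded V := by
    change Bornology.IsVonNBounded ℝ {A : GrModel k n | V.metricInner A A < 1}
    refine (NormedSpace.isVonNBounded_ball ℝ (GrModel k n) 1).subset fun A hA => ?_
    have h1 := sq_opNorm_le_opTrace (show Cn k →L[ℂ] Cn (n - k) from A)
    have h2 : V.fubiniStudy A A < 1 := (V.metricInner_apply A A).symm.trans_lt hA
    have h3 : 2 * (opTrace (adjoint (show Cn k →L[ℂ] Cn (n - k) from A) ∘L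
      (show Cn k →L[ℂ] Cn (n - k) from A))).re < 1 := h2
    rw [mem_ball_zero_iff]
    change ‖(show Cn k →L[ℂ] Cn (n - k) from A)‖ < 1
    nlinarith [norm_nonneg (show Cn k →L[ℂ] Cn (n - k) from A)]
  contMDiff := contMDiff_metricInner

/-! ### The geodesic symmetries -/

/-- The orthogonal reflection of `ℂⁿ` in the subspace `V`, as an operator. -/
def reflOp (V : Gr k n) : Op n := V.1.reflection.toContinuousLinearEquiv.toContinuousLinearMap

lemma reflOp_reflOp (V : Gr k n) (x) : V.reflOp (V.reflOp x) = x := V.1.reflection_reflection x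

lemma reflOp_comp_reflOp (V : Gr k n) : V.reflOp ∘L V.reflOp = 1 :=
  ContinuousLinearMap.ext V.reflOp_reflOp

lemma reflOp_e (V : Gr k n) (x) : V.reflOp (V.e x) = V.e x :=
  Submodule.reflection_mem_subspace_eq_self (V.e_mem x)

lemma reflOp_f (V : Gr k n) (x) : V.reflOp (V.f x) = -V.f x :=
  Submodule.reflection_mem_subspace_orthogonalComplement_eq_neg (V.f_mem x)

lemma reflOp_apply (V : Gr k n) (x) :
    V.reflOp x = V.e (adjoint V.e x) - V.f (adjoint V.f x) := by
  conv_lhs => rw [← V.e_add_f_apply x, map_add, reflOp_e, reflOp_f, ← sub_eq_add_neg]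

/-- The geodesic symmetry of the Grassmannian at `V`: the map induced by the reflection in `V`. -/
def reflect (V W : Gr k n) : Gr k n :=
  ⟨W.1.map (V.1.reflection.toLinearEquiv : Cn n →ₗ[ℂ] Cn n), by
    rw [LinearEquiv.finrank_map_eq]; exact W.2⟩

lemma proj_reflect (V W : Gr k n) :
    (V.reflect W).proj = V.reflOp ∘L W.proj ∘L V.reflOp := by
  ext1 x
  refine (Submodule.starProjection_map_apply V.1.reflection W.1 x).trans ?_
  rw [Submodule.reflection_symm]
  rfl

lemma reflect_involutive (V : Gr k n) : Function.Involutive V.reflect := fun W =>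
  proj_injective <| by
    rw [proj_reflect, proj_reflect]
    ext1 x
    simp only [ContinuousLinearMap.comp_apply, reflOp_reflOp]

lemma reflect_self (V : Gr k n) : V.reflect V = V := proj_injective <| by
  rw [proj_reflect]
  ext1 x
  simp only [ContinuousLinearMap.comp_apply, proj_apply, reflOp_apply, map_sub, adjoint_e_e,
    adjoint_e_f, adjoint_f_e, map_zero, sub_zero]

lemma reflOp_comp_graphMap (V : Gr k n) (A : Cn k →L[ℂ] Cn (n - k)) :
    V.reflOp ∘L V.graphMap A = V.graphMap (-A) := by
  ext1 x
  simp only [graphMap, ContinuousLinearMap.comp_apply, add_apply, map_add, reflOp_e, reflOp_f,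
    neg_apply, map_neg]

/-- In the chart at `V` the symmetry at `V` is `A ↦ -A`. -/
lemma reflect_graph (V : Gr k n) (A : Cn k →L[ℂ] Cn (n - k)) :
    V.reflect (V.graph A) = V.graph (-A) := by
  refine Subtype.ext ?_
  change Submodule.map _ (V.graphMap A).range = (V.graphMap (-A)).range
  rw [← reflOp_comp_graphMap]
  exact (LinearMap.range_comp _ _).symm

lemma opTrace_conj_reflOp (V : Gr k n) (X Y : Op n) :
    opTrace ((V.reflOp ∘L X ∘L V.reflOp) ∘L (V.reflOp ∘L Y ∘L V.reflOp)) = opTrace (X ∘L Y) := by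
  rw [show (V.reflOp ∘L X ∘L V.reflOp) ∘L (V.reflOp ∘L Y ∘L V.reflOp)
      = V.reflOp ∘L (X ∘L Y ∘L V.reflOp) by
    ext1 x; simp only [ContinuousLinearMap.comp_apply, reflOp_reflOp], opTrace_comp_comm]
  congr 1
  simp only [ContinuousLinearMap.comp_assoc, reflOp_comp_reflOp]
  rfl

/-- Conjugation by the reflection in `V`, as a real-linear map. -/
def conjReflL (V : Gr k n) : Op n →L[ℝ] Op n :=
  (((ContinuousLinearMap.compL ℂ (Cn n) (Cn n) (Cn n) V.reflOp) ∘L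
    ((ContinuousLinearMap.compL ℂ (Cn n) (Cn n) (Cn n)).flip V.reflOp))).restrictScalars ℝ

lemma traceForm_conjReflL (V : Gr k n) (X Y : Op n) :
    traceForm n (V.conjReflL X) (V.conjReflL Y) = traceForm n X Y :=
  congrArg Complex.re (V.opTrace_conj_reflOp X Y)

/-! ### The metric in charts, and the Kähler condition -/

lemma mdifferentiableAt_graph (V : Gr k n) (z : GrModel k n) :
    MDifferentiableAt (M := GrModel k n) 𝓘(ℝ, GrModel k n) 𝓘(ℝ, GrModel k n) V.graph z :=
  mdifferentiableAt_atlas_symm (I := 𝓘(ℝ, GrModel k n)) (chart_mem_atlas (GrModel k n) V)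
    (Set.mem_univ z)

lemma mdifferentiableAt_proj (V : Gr k n) :
    MDifferentiableAt 𝓘(ℝ, GrModel k n) 𝓘(ℝ, Op n) proj V :=
  (contMDiff_proj (m := 1)).mdifferentiable one_ne_zero V

lemma dproj_coordVector (V : Gr k n) (z v : GrModel k n) :
    (V.graph z).dproj (coordVector V z v) =
      fderiv ℝ (fun A : GrModel k n => (V.graph A).proj) z v := by
  have h := mfderiv_comp (M := GrModel k n) z (V.graph z).mdifferentiableAt_proj
    (V.mdifferentiableAt_graph z)
  rw [← mfderiv_eq_fderiv]
  exact (DFunLike.congr_fun h v).symm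

lemma metricCoeff_metric (V : Gr k n) (z v w : GrModel k n) :
    metricCoeff (metric k n) V z v w =
      traceForm n (fderiv ℝ (fun A : GrModel k n => (V.graph A).proj) z v)
        (fderiv ℝ (fun A : GrModel k n => (V.graph A).proj) z w) := by
  rw [← dproj_coordVector, ← dproj_coordVector]
  rfl

lemma fderiv_comp_neg_apply {E F : Type*} [NormedAddCommGroup E] [NormedSpace ℝ E]
    [NormedAddCommGroup F] [NormedSpace ℝ F] (h : E → F) (z v : E) :
    fderiv ℝ (fun y => h (-y)) z v = -fderiv ℝ h (-z) v := by
  have h1 := (ContinuousLinearEquiv.neg ℝ (M := E)).comp_right_fderiv (f := h) (x := z)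
  have h2 : fderiv ℝ (fun y => h (-y)) z v = fderiv ℝ h (-z) (-v) := DFunLike.congr_fun h1 v
  rw [h2, map_neg]

lemma fderiv_proj_graph_neg (V : Gr k n) (z v : GrModel k n) :
    fderiv ℝ (fun A : GrModel k n => (V.graph A).proj) (-z) v =
      -V.conjReflL (fderiv ℝ (fun A : GrModel k n => (V.graph A).proj) z v) := by
  set Ψ : GrModel k n → Op n := fun A => (V.graph A).proj with hΨ
  have h : (fun A => Ψ (-A)) = fun A => V.conjReflL (Ψ A) := funext fun A =>
    (congrArg proj (V.reflect_graph A)).symm.trans (V.proj_reflect _)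
  have hd : DifferentiableAt ℝ Ψ z := (V.contDiff_proj_graph (m := 1)).differentiable one_ne_zero z
  have h1 := fderiv_comp_neg_apply Ψ z v
  rw [h, show fderiv ℝ (fun A => V.conjReflL (Ψ A)) z = _ from
    (V.conjReflL.hasFDerivAt.comp z hd.hasFDerivAt).fderiv] at h1
  rw [← neg_eq_iff_eq_neg, ← h1]
  rfl

/-- The coefficients of the metric are even functions in the chart, since the symmetry at the
centre of the chart is an isometry. -/
lemma metricCoeff_neg (V : Gr k n) (z v w : GrModel k n) :
    metricCoeff (metric k n) V (-z) v w = metricCoeff (metric k n) V z v w := by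
  rw [metricCoeff_metric, metricCoeff_metric, fderiv_proj_graph_neg, fderiv_proj_graph_neg,
    map_neg, map_neg, neg_apply, neg_neg, traceForm_conjReflL]

lemma eq_zero_of_eq_neg {E : Type*} [NormedAddCommGroup E] [NormedSpace ℝ E] {v : E}
    (h : v = -v) : v = 0 := by
  have : (2 : ℝ) • v = 0 := by rw [two_smul]; exact eq_neg_iff_add_eq_zero.1 h
  exact (smul_eq_zero.1 this).resolve_left two_ne_zero

lemma fderiv_zero_of_even {E F : Type*} [NormedAddCommGroup E] [NormedSpace ℝ E]
    [NormedAddCommGroup F] [NormedSpace ℝ F] {h : E → F} (he : ∀ z, h (-z) = h z) :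
    fderiv ℝ h 0 = 0 := by
  ext1 v
  have h1 := fderiv_comp_neg_apply h 0 v
  simp only [he, neg_zero] at h1
  exact eq_zero_of_eq_neg h1

lemma fderiv_metricCoeff (V : Gr k n) (v w : GrModel k n) :
    fderiv ℝ (fun z => metricCoeff (metric k n) V z v w) 0 = 0 :=
  fderiv_zero_of_even fun z => V.metricCoeff_neg z v w

lemma christoffel_metric (V : Gr k n) (u v w : GrModel k n) :
    christoffel (metric k n) V 0 u v w = 0 := by
  simp only [christoffel, fderiv_metricCoeff, zero_apply, add_zero, sub_zero, zero_div]

lemma differentiableAt_transition (V V' : Gr k n) (A : GrModel k n)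
    (h : IsUnit (V'.compr (V.graph A))) :
    DifferentiableAt ℂ (V'.slope ∘ V.graph : GrModel k n → GrModel k n) A := by
  have ho : IsOpen {A : GrModel k n | IsUnit (V'.compr (V.graph A))} :=
    V'.chart.open_source.preimage V.continuous_graph
  exact ((contDiffOn_transition V V').contDiffAt (ho.mem_nhds h)).differentiableAt (by simp)

/-- The charts are holomorphic, so their coordinate vector fields are complex linear. -/
lemma coordVector_I_smul (V : Gr k n) (z v : GrModel k n) :
    coordVector V z (I • v) = complexStructure _ (coordVector V z v) := by
  have h1 := V.differentiableAt_transition (V.graph z) z (V.graph z).isUnit_compr_self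
  have h2 : (mfderiv (M := GrModel k n) 𝓘(ℝ, GrModel k n) 𝓘(ℝ, GrModel k n) V.graph z :
      GrModel k n →L[ℝ] GrModel k n) = fderiv ℝ ((V.graph z).slope ∘ V.graph) z := by
    rw [(V.mdifferentiableAt_graph z).mfderiv, modelWithCornersSelf_coe, Set.range_id,
      fderivWithin_univ]
    rfl
  have h (v : GrModel k n) : (coordVector V z v : GrModel k n) =
      fderiv ℂ ((V.graph z).slope ∘ V.graph : GrModel k n → GrModel k n) z v := by
    refine (DFunLike.congr_fun h2 v).trans ?_
    exact DFunLike.congr_fun (h1.hasFDerivAt.restrictScalars ℝ).fderiv v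
  refine (h _).trans (((map_smul (fderiv ℂ ((V.graph z).slope ∘ V.graph :
    GrModel k n → GrModel k n) z) I v)).trans ?_)
  exact congrArg (fun w : GrModel k n => I • w) (h v).symm

lemma kaehlerFormCoeff_metric (V : Gr k n) (z v w : GrModel k n) :
    kaehlerFormCoeff (metric k n) V z v w = metricCoeff (metric k n) V z (I • v) w := by
  rw [metricCoeff, coordVector_I_smul]
  rfl

lemma isHermitianMetric_metric : IsHermitianMetric (metric k n) := by
  intro V A B
  change V.metricInner _ _ = V.metricInner _ _
  rw [metricInner_apply, metricInner_apply]
  have h (A B : Cn k →L[ℂ] Cn (n - k)) : adjoint (I • A) ∘L (I • B) = adjoint A ∘L B := by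
    rw [map_smulₛₗ, Complex.conj_I, ContinuousLinearMap.smul_comp, ContinuousLinearMap.comp_smul,
      smul_smul, neg_mul, Complex.I_mul_I, neg_neg, one_smul]
  exact congrArg (fun X : Cn k →L[ℂ] Cn k => 2 * (opTrace X).re) (h A B)

lemma isKaehlerMetric_metric : IsKaehlerMetric (metric k n) := by
  refine ⟨isHermitianMetric_metric, fun V u v w => ?_⟩
  rw [show chartAt (GrModel k n) V V = 0 from V.slope_self]
  simp only [kaehlerFormCoeff_metric, fderiv_metricCoeff, zero_apply, add_zero]

/-! ### The symmetries are holomorphic isometries with isolated fixed points -/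

lemma contMDiff_reflect (V : Gr k n) :
    ContMDiff 𝓘(ℝ, GrModel k n) 𝓘(ℝ, GrModel k n) ∞ V.reflect := fun W => by
  refine contMDiffWithinAt_iff_proj.2 ?_
  simp only [proj_reflect]
  exact (V.conjReflL.contMDiff.comp contMDiff_proj).contMDiffAt

lemma preservesMetric_reflect (V : Gr k n) : PreservesMetric (metric k n) V.reflect := by
  refine ⟨V.contMDiff_reflect, fun W A B => ?_⟩
  have h (A : GrModel k n) : (V.reflect W).dproj
      (mfderiv 𝓘(ℝ, GrModel k n) 𝓘(ℝ, GrModel k n) V.reflect W A) = V.conjReflL (W.dproj A) := by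
    have h1 := mfderiv_comp W (V.reflect W).mdifferentiableAt_proj
      (V.contMDiff_reflect.mdifferentiable (by simp) W)
    have h2 := mfderiv_comp W (V.conjReflL.differentiableAt.mdifferentiableAt)
      W.mdifferentiableAt_proj
    have h3 : proj ∘ V.reflect = V.conjReflL ∘ proj := funext fun W => V.proj_reflect W
    rw [h3, h2, mfderiv_eq_fderiv, V.conjReflL.fderiv] at h1
    exact (DFunLike.congr_fun h1 A).symm
  refine (congrArg₂ (fun X Y => traceForm n X Y) (h A) (h B)).trans ?_
  exact V.traceForm_conjReflL _ _

/-- If `T` is a holomorphic family of injective maps, the slope of the range of `T` is the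
holomorphic function `(f* T) (e* T)⁻¹`; here `T = S (e + f A)` with `S` the reflection. -/
lemma mdifferentiable_reflect (V : Gr k n) :
    MDifferentiable 𝓘(ℂ, GrModel k n) 𝓘(ℂ, GrModel k n) V.reflect := by
  intro W
  refine (mdifferentiableAt_iff _ _).2 ⟨(V.contMDiff_reflect.continuous).continuousAt, ?_⟩
  have h0 : extChartAt 𝓘(ℂ, GrModel k n) W W = 0 := W.slope_self
  rw [modelWithCornersSelf_coe, Set.range_id, differentiableWithinAt_univ, h0]
  set V' := V.reflect W with hV'
  have hT (A : GrModel k n) : Function.Injective (V.reflOp ∘L W.graphMap A) :=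
    V.1.reflection.injective.comp (W.graphMap_injective A)
  have hr (A : GrModel k n) : (V.reflect (W.graph A)).1 = (V.reflOp ∘L W.graphMap A).range :=
    (LinearMap.range_comp _ _).symm
  have ho : ∀ᶠ A : GrModel k n in nhds 0, IsUnit (V'.compr (V.reflect (W.graph A))) := by
    refine (V'.chart.open_source.preimage
      (V.contMDiff_reflect.continuous.comp W.continuous_graph)).mem_nhds ?_
    change IsUnit (V'.compr (V.reflect (W.graph 0)))
    rw [graph_zero]
    exact V'.isUnit_compr_self
  have hd : Differentiable ℂ (fun A : GrModel k n => V.reflOp ∘L W.graphMap A) :=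
    (contDiff_const.clm_comp (W.contDiff_graphMap (m := 1))).differentiable one_ne_zero
  have hs (A : GrModel k n) (hA : IsUnit (V'.compr (V.reflect (W.graph A)))) :=
    V'.slope_range (hT A) (V.reflect (W.graph A)) (hr A) hA
  have h1 : DifferentiableAt ℂ (fun A : GrModel k n =>
      ((adjoint V'.f ∘L V.reflOp ∘L W.graphMap A) ∘L
        Ring.inverse (adjoint V'.e ∘L V.reflOp ∘L W.graphMap A) : GrModel k n)) 0 := by
    have hi : DifferentiableAt ℂ Ring.inverse (adjoint V'.e ∘L V.reflOp ∘L W.graphMap 0) :=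
      differentiableAt_inverse (𝕜 := ℂ) (hs 0 ho.self_of_nhds).1
    refine DifferentiableAt.clm_comp ?_ ?_
    · exact (differentiableAt_const _).clm_comp (hd 0)
    · exact DifferentiableAt.comp 0 (f := fun A : GrModel k n =>
        adjoint V'.e ∘L V.reflOp ∘L W.graphMap A) hi ((differentiableAt_const _).clm_comp (hd 0))
  refine h1.congr_of_eventuallyEq ?_
  filter_upwards [ho] with A hA
  exact (hs A hA).2

lemma eventually_reflect_ne (V : Gr k n) : ∀ᶠ W in nhdsWithin V {V}ᶜ, V.reflect W ≠ W := by
  have h := V.chart.open_source.mem_nhds V.mem_chart_source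
  filter_upwards [nhdsWithin_le_nhds h, self_mem_nhdsWithin] with W hW hne heq
  refine hne ?_
  have h1 : V.graph (V.slope W) = W := V.graph_slope W hW
  rw [← h1, reflect_graph] at heq
  have h2 : -(V.slope W : GrModel k n) = V.slope W := by
    have := congrArg V.slope heq
    rwa [slope_graph, slope_graph] at this
  have h3 : (V.slope W : GrModel k n) = 0 := eq_zero_of_eq_neg h2.symm
  exact h1.symm.trans ((congrArg V.graph h3).trans V.graph_zero)

/-! ### Connectedness -/

lemma isUnit_compr_of_range (V W : Gr k n) {T : Cn k →L[ℂ] Cn n} (hT : Function.Injective T)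
    (hW : W.1 = T.range) (hu : IsUnit (adjoint V.e ∘L T)) : IsUnit (V.compr W) := by
  have h1 : W.1.starProjection = T ∘L Ring.inverse (adjoint T ∘L T) ∘L adjoint T := by
    rw [← starProjection_range hT]
    simp only [hW]
  have h2 : V.compr W = (adjoint V.e ∘L T) * Ring.inverse (adjoint T ∘L T) *
      adjoint (adjoint V.e ∘L T) := by
    rw [compr, h1, ContinuousLinearMap.adjoint_comp, ContinuousLinearMap.adjoint_adjoint]
    rfl
  rw [h2]
  exact (hu.mul (isUnit_gram hT).ringInverse).mul (hu.star)

/-- Any two charts overlap: the image of `e + z e'` lies in both domains for all but finitely many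
`z : ℂ`. -/
lemma exists_mem_source_inter (V V' : Gr k n) : (V.chart.source ∩ V'.chart.source).Nonempty := by
  set A : Module.End ℂ (Cn k) := (adjoint V.e ∘L V'.e).toLinearMap with hA
  set B : Module.End ℂ (Cn k) := (adjoint V'.e ∘L V.e).toLinearMap with hB
  obtain ⟨z, hz⟩ := (((Set.finite_singleton (0 : ℂ)).union
    (A.finite_hasEigenvalue.image fun μ => -μ⁻¹)).union
      (B.finite_hasEigenvalue.image fun μ => -μ)).exists_notMem
  simp only [Set.mem_union, Set.mem_singleton_iff, Set.mem_image, not_or, not_exists] at hz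
  obtain ⟨⟨hz0, hzA⟩, hzB⟩ := hz
  set T : Cn k →L[ℂ] Cn n := V.e + z • V'.e with hTdef
  have h1 : IsUnit (adjoint V.e ∘L T) := by
    refine isUnit_of_injective ((injective_iff_map_eq_zero _).2 fun x hx => ?_)
    by_contra hx0
    refine hzA (-z⁻¹) ⟨Module.End.hasEigenvalue_of_hasEigenvector ⟨?_, hx0⟩, by simp⟩
    rw [Module.End.mem_eigenspace_iff]
    have h : x + z • A x = 0 := by
      simpa [hTdef, adjoint_e_e, hA] using hx
    rw [neg_smul, eq_neg_iff_add_eq_zero]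
    have := congrArg (fun y => z⁻¹ • y) h
    simpa [smul_smul, hz0, add_comm] using this
  have h2 : IsUnit (adjoint V'.e ∘L T) := by
    refine isUnit_of_injective ((injective_iff_map_eq_zero _).2 fun x hx => ?_)
    by_contra hx0
    refine hzB (-z) ⟨Module.End.hasEigenvalue_of_hasEigenvector ⟨?_, hx0⟩, by simp⟩
    rw [Module.End.mem_eigenspace_iff]
    have h : B x + z • x = 0 := by
      simpa [hTdef, adjoint_e_e, hB] using hx
    rw [neg_smul, eq_neg_iff_add_eq_zero, h]
  have hT : Function.Injective T :=
    Function.Injective.of_comp (f := adjoint V.e) (ContinuousLinearMap.isUnit_iff_bijective.1 h1).1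
  exact ⟨⟨T.range, finrank_range hT⟩, V.isUnit_compr_of_range _ hT rfl h1,
    V'.isUnit_compr_of_range _ hT rfl h2⟩

lemma isPreconnected_chart_source (V : Gr k n) : IsPreconnected V.chart.source := by
  have h : V.chart.source = Set.range V.graph := by
    ext W
    exact ⟨fun hW => ⟨V.slope W, V.graph_slope W hW⟩, by
      rintro ⟨A, rfl⟩; exact V.isUnit_compr_graph A⟩
  rw [h]
  exact isPreconnected_range V.continuous_graph

lemma nonempty (hk : k ≤ n) : Nonempty (Gr k n) := by
  have hli : LinearIndependent ℂ fun i : Fin k =>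
      EuclideanSpace.basisFun (Fin n) ℂ (Fin.castLE hk i) :=
    (EuclideanSpace.basisFun (Fin n) ℂ).orthonormal.linearIndependent.comp _
      (Fin.castLE_injective hk)
  exact ⟨⟨_, (finrank_span_eq_card hli).trans (Fintype.card_fin k)⟩⟩

lemma connectedSpace (hk : k ≤ n) : ConnectedSpace (Gr k n) where
  toNonempty := nonempty hk
  isPreconnected_univ := isPreconnected_of_forall_pair fun V _ V' _ =>
    ⟨V.chart.source ∪ V'.chart.source, Set.subset_univ _, Or.inl V.mem_chart_source,
      Or.inr V'.mem_chart_source, V.isPreconnected_chart_source.union'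
        (V.exists_mem_source_inter V') V'.isPreconnected_chart_source⟩

lemma isHermitianSymmetricSpace_metric (hk : k ≤ n) :
    IsHermitianSymmetricSpace (metric k n) where
  t2 := inferInstance
  secondCountable := inferInstance
  connected := connectedSpace hk
  complexManifold := inferInstance
  hermitian := isHermitianMetric_metric
  symmetric V := ⟨V.reflect, V.reflect_involutive, V.mdifferentiable_reflect,
    V.preservesMetric_reflect, V.reflect_self, V.eventually_reflect_ne⟩

/-! ### The embedding into the space of skew-Hermitian operators -/

/-- The skew-Hermitian operator which is `i/2` on `V` and `-i/2` on `Vᗮ`. -/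
def theta (V : Gr k n) : Op n := I • V.proj - (I / 2) • 1

lemma eigenspace_theta (V : Gr k n) :
    Module.End.eigenspace (V.theta : Cn n →ₗ[ℂ] Cn n) (I / 2) = V.1 := by
  ext x
  rw [Module.End.mem_eigenspace_iff, ← proj_eq_self_iff]
  change I • V.proj x - (I / 2) • x = (I / 2) • x ↔ _
  rw [sub_eq_iff_eq_add, ← add_smul, add_halves]
  exact smul_right_inj Complex.I_ne_zero

/-- The affine homeomorphism of the space of operators that takes projections to points of the
adjoint orbit. -/
def thetaHomeo (n : ℕ) : Op n ≃ₜ Op n :=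
  (Homeomorph.smulOfNeZero I Complex.I_ne_zero).trans (Homeomorph.addRight (-((I / 2) • 1)))

lemma isEmbedding_theta : Topology.IsEmbedding (theta : Gr k n → Op n) :=
  (funext fun _ => (sub_eq_add_neg _ _).symm : thetaHomeo n ∘ proj = (theta : Gr k n → Op n)) ▸
    (thetaHomeo n).isEmbedding.comp isEmbedding_proj

/-- Multiplication by `i` on operators, as a real-linear map. -/
def smulIL (n : ℕ) : Op n →L[ℝ] Op n :=
  (I • ContinuousLinearMap.id ℂ (Op n)).restrictScalars ℝ

lemma I_smul_I_smul (X : Op n) : I • I • X = -X := by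
  ext1 x
  simp only [smul_apply, neg_apply, smul_smul, Complex.I_mul_I, neg_smul, one_smul]

lemma contMDiff_theta : ContMDiff 𝓘(ℝ, GrModel k n) 𝓘(ℝ, Op n) ∞ (theta : Gr k n → Op n) :=
  ((smulIL n).contDiff.sub contDiff_const).contMDiff.comp contMDiff_proj

lemma mfderiv_theta (V : Gr k n) (A : GrModel k n) :
    mfderiv 𝓘(ℝ, GrModel k n) 𝓘(ℝ, Op n) theta V A = I • V.tangentOp A := by
  have h1 : HasFDerivAt (fun X : Op n => smulIL n X - (I / 2) • 1) (smulIL n) V.proj :=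
    (smulIL n).hasFDerivAt.sub_const _
  have h2 := mfderiv_comp V h1.differentiableAt.mdifferentiableAt V.mdifferentiableAt_proj
  rw [mfderiv_eq_fderiv, h1.fderiv] at h2
  exact (DFunLike.congr_fun h2 A).trans (congrArg (smulIL n) (V.mfderiv_proj A))

lemma mfderiv_theta_injective (V : Gr k n) :
    Function.Injective (mfderiv 𝓘(ℝ, GrModel k n) 𝓘(ℝ, Op n) theta V) := by
  intro A B hAB
  have h1 := (V.mfderiv_theta A).symm.trans (hAB.trans (V.mfderiv_theta B))
  have h2 : V.tangentOp A = V.tangentOp B := (smul_right_inj Complex.I_ne_zero).1 h1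
  exact (V.f_tangentOp_e A).symm.trans
    ((congrArg (fun X : Op n => adjoint V.f ∘L X ∘L V.e) h2).trans (V.f_tangentOp_e B))

lemma metric_eq_uForm (V : Gr k n) (A B : TangentSpace 𝓘(ℝ, GrModel k n) V) :
    (((metric k n).inner V A B : ℝ) : ℂ) =
      uForm (mfderiv 𝓘(ℝ, GrModel k n) 𝓘(ℝ, Op n) theta V A)
        (mfderiv 𝓘(ℝ, GrModel k n) 𝓘(ℝ, Op n) theta V B) := by
  have h : uForm (I • V.tangentOp A) (I • V.tangentOp B) = ((V.fubiniStudy A B : ℝ) : ℂ) := by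
    refine Eq.trans ?_ (V.opTrace_tangentOp_mul A B)
    rw [uForm, ContinuousLinearMap.smul_comp, ContinuousLinearMap.comp_smul, smul_smul,
      Complex.I_mul_I, ContinuousLinearMap.toLinearMap_smul, map_smul, neg_one_smul, neg_neg]
  refine Eq.trans ?_ (h.symm.trans (congrArg₂ uForm (V.mfderiv_theta A) (V.mfderiv_theta B)).symm)
  exact congrArg _ (V.metricInner_apply A B)

lemma contDiffOn_theta_comp_iff {γ : ℝ × ℝ → Gr k n} {U : Set (ℝ × ℝ)} :
    ContDiffOn ℝ ∞ (theta ∘ γ) U ↔ ContDiffOn ℝ ∞ (fun z => (γ z).proj) U := by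
  constructor
  · intro h
    have h1 := ((smulIL n).contDiff.neg (n := ∞)).comp_contDiffOn
      (h.add (contDiffOn_const (c := (I / 2) • 1)))
    refine h1.congr fun z _ => ?_
    change _ = -(I • ((I • (γ z).proj - (I / 2) • 1) + (I / 2) • 1))
    rw [sub_add_cancel, I_smul_I_smul, neg_neg]
  · intro h
    exact ((smulIL n).contDiff.sub contDiff_const).comp_contDiffOn h

lemma contMDiffOn_iff_theta {γ : ℝ × ℝ → Gr k n} {U : Set (ℝ × ℝ)} :
    ContMDiffOn 𝓘(ℝ, ℝ × ℝ) 𝓘(ℝ, GrModel k n) ∞ γ U ↔ ContDiffOn ℝ ∞ (theta ∘ γ) U := by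
  rw [contDiffOn_theta_comp_iff, ← contMDiffOn_iff_contDiffOn]
  exact forall₂_congr fun z _ => contMDiffWithinAt_iff_proj

/-! ### The geometric non-linear Schrödinger equation -/

lemma mfderiv_curve {c : ℝ → Gr k n} {s : ℝ} (h : ContDiffAt ℝ 1 (fun r => (c r).proj) s) :
    mfderiv 𝓘(ℝ, ℝ) 𝓘(ℝ, GrModel k n) c s (1 : ℝ) =
      adjoint (c s).f ∘L deriv (fun r => (c r).proj) s ∘L (c s).e := by
  have h1 : ContMDiffWithinAt 𝓘(ℝ, ℝ) 𝓘(ℝ, GrModel k n) (1 : ℕ∞) c Set.univ s :=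
    contMDiffWithinAt_iff_proj.2 h.contMDiffAt.contMDiffWithinAt
  have h2 := (contMDiffWithinAt_univ.1 h1).mdifferentiableAt one_ne_zero
  have h3 := hasDerivAt_slope (h.differentiableAt one_ne_zero).hasDerivAt
  rw [h2.mfderiv, modelWithCornersSelf_coe, Set.range_id, fderivWithin_univ]
  exact (DFunLike.congr_fun h3.hasFDerivAt.fderiv (1 : ℝ)).trans (one_smul ℝ _)

/-- The Christoffel symbols vanish at the centre of the chart, so the covariant acceleration is the
second derivative in that chart. -/
lemma isCovariantAcceleration_metric_iff {c : ℝ → Gr k n} {s : ℝ}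
    (h : ContDiffAt ℝ 2 (fun r => (c r).proj) s) (ξ : GrModel k n) :
    IsCovariantAcceleration (metric k n) c s ξ ↔
      ξ = adjoint (c s).f ∘L iteratedDeriv 2 (fun r => (c r).proj) s ∘L (c s).e := by
  rw [← iteratedDeriv_two_slope h]
  set η : GrModel k n := iteratedDeriv 2 (fun r => ((c s).slope (c r) : GrModel k n)) s
  have h1 : IsCovariantAcceleration (metric k n) c s ξ ↔
      ∀ w : GrModel k n, (c s).metricInner ξ w = (c s).metricInner η w := by
    refine forall_congr' fun w => ?_
    have h0 : chartAt (GrModel k n) (c s) (c s) = 0 := (c s).slope_self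
    change (c s).metricInner ξ w = (c s).metricInner η w + christoffel (metric k n) (c s)
      (chartAt (GrModel k n) (c s) (c s)) _ _ _ ↔ _
    have h2 := (c s).christoffel_metric (deriv (fun r => (c s).slope (c r)) s)
      (deriv (fun r => (c s).slope (c r)) s) w
    rw [← h0] at h2
    refine Eq.congr_right ((congrArg _ h2).trans (add_zero _))
  rw [h1]
  refine ⟨fun hw => ?_, fun hξ w => congrArg (fun ζ => (c s).metricInner ζ w) hξ⟩
  by_contra hne
  have h2 := (metric k n).pos (c s) (ξ - η) (sub_ne_zero.2 hne)
  have h3 : (c s).metricInner (ξ - η) (ξ - η) = 0 := by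
    refine (congrArg (fun F => F (ξ - η)) (map_sub (c s).metricInner ξ η)).trans ?_
    exact sub_eq_zero.2 (hw _)
  exact h2.ne' h3

lemma adjoint_iteratedDeriv_two_proj {c : ℝ → Gr k n} {s : ℝ}
    (h : ContDiffAt ℝ 2 (fun r => (c r).proj) s) :
    adjoint (iteratedDeriv 2 (fun r => (c r).proj) s) =
      iteratedDeriv 2 (fun r => (c r).proj) s := by
  set P : ℝ → Op n := fun r => (c r).proj with hP
  have h1 : (fun r => adjoint (deriv P r)) =ᶠ[nhds s] deriv P := by
    filter_upwards [h.eventually (by simp)] with r hr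
    have hd := (hr.differentiableAt two_ne_zero).hasDerivAt
    have := hasDerivAt_adjoint hd
    simp only [hP, adjoint_proj] at this
    exact this.unique hd
  have h2 : HasDerivAt (deriv P) (iteratedDeriv 2 P s) s := by
    rw [iteratedDeriv_succ, iteratedDeriv_one]
    exact ((h.derivWithin (m := 1) le_rfl).differentiableAt one_ne_zero).hasDerivAt
  exact (hasDerivAt_adjoint h2).unique (h2.congr_of_eventuallyEq h1)

lemma hasDerivAt_theta {c : ℝ → Gr k n} {s : ℝ} {P' : Op n}
    (h : HasDerivAt (fun r => (c r).proj) P' s) :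
    HasDerivAt (fun r => (c r).theta) (I • P') s :=
  ((smulIL n).hasFDerivAt.comp_hasDerivAt s h).sub_const _

lemma iteratedDeriv_two_theta {c : ℝ → Gr k n} {s : ℝ}
    (h : ContDiffAt ℝ 2 (fun r => (c r).proj) s) :
    iteratedDeriv 2 (fun r => (c r).theta) s = I • iteratedDeriv 2 (fun r => (c r).proj) s := by
  have h1 : deriv (fun r => (c r).theta) =ᶠ[nhds s]
      fun r => smulIL n (deriv (fun r => (c r).proj) r) := by
    filter_upwards [h.eventually (by simp)] with r hr
    exact (hasDerivAt_theta (hr.differentiableAt two_ne_zero).hasDerivAt).deriv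
  have h2 := ((h.derivWithin (m := 1) le_rfl).differentiableAt one_ne_zero).hasDerivAt
  rw [iteratedDeriv_succ, iteratedDeriv_one, iteratedDeriv_succ, iteratedDeriv_one, h1.deriv_eq]
  exact ((smulIL n).hasFDerivAt.comp_hasDerivAt s h2).deriv

lemma lie_theta (V : Gr k n) (Y : Op n) :
    ⁅V.theta, I • Y⁆ = Y * V.proj - V.proj * Y := by
  have h (X Y : Op n) : (I • X) * (I • Y) = -(X * Y) := by
    rw [smul_mul_assoc, mul_smul_comm, I_smul_I_smul]
  rw [Ring.lie_def, theta, sub_mul, mul_sub, h, h, smul_one_mul, mul_smul_one,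
    sub_sub_sub_cancel_right, neg_sub_neg]

/-- In the chart at `γ (x, t)` the equation reads `i u_t = u_xx`, and both sides are the blocks
`V → Vᗮ` of the two sides of the equation for operators. -/
lemma gnlsAt_metric_iff {γ : ℝ × ℝ → Gr k n} {x t : ℝ}
    (hx : ContDiffAt ℝ 2 (fun r => (γ (r, t)).proj) x)
    (ht : ContDiffAt ℝ 1 (fun r => (γ (x, r)).proj) t) :
    GNLSAt (metric k n) γ x t ↔ deriv (fun s => theta (γ (x, s))) t =
      ⁅theta (γ (x, t)), iteratedDeriv 2 (fun r => theta (γ (r, t))) x⁆ := by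
  have hd := (ht.differentiableAt one_ne_zero).hasDerivAt
  rw [(hasDerivAt_theta (c := fun s => γ (x, s)) hd).deriv,
    iteratedDeriv_two_theta (c := fun r => γ (r, t)) hx, lie_theta,
    eq_tangentOp_of_hasDerivAt (c := fun s => γ (x, s)) hd,
    smul_tangentOp_eq_commutator_iff _ _
      (adjoint_iteratedDeriv_two_proj (c := fun r => γ (r, t)) hx)]
  have h1 : complexStructure (γ (x, t))
      (mfderiv 𝓘(ℝ, ℝ) 𝓘(ℝ, GrModel k n) (fun r => γ (x, r)) t (1 : ℝ)) =
      I • (adjoint (γ (x, t)).f ∘L deriv (fun r => (γ (x, r)).proj) t ∘L (γ (x, t)).e) :=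
    congrArg (fun A : GrModel k n => I • A) (mfderiv_curve (c := fun s => γ (x, s)) ht)
  rw [GNLSAt, h1]
  exact isCovariantAcceleration_metric_iff (c := fun r => γ (r, t)) hx _

/-! ### The image is the adjoint orbit -/

/-- The matrix `a` is `i d - i/2` for the diagonal projection `d` of rank `k`, as `theta` is
`i P - i/2`. -/
lemma theta_eq_iff (V : Gr k n) (g : Matrix (Fin n) (Fin n) ℂ)
    (hg : g ∈ Matrix.unitaryGroup (Fin n) ℂ) :
    V.theta = Matrix.toEuclideanCLM (𝕜 := ℂ) (g * aMatrix k n * g⁻¹) ↔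
      V.proj = Matrix.toEuclideanCLM (𝕜 := ℂ)
        (g * Matrix.diagonal (fun j : Fin n => if (j : ℕ) < k then 1 else 0) * star g) := by
  have hinv : g⁻¹ = star g := Matrix.inv_eq_right_inv (Matrix.mem_unitaryGroup_iff.1 hg)
  have ha : aMatrix k n = I • Matrix.diagonal (fun j : Fin n => if (j : ℕ) < k then (1 : ℂ) else 0)
      - (I / 2) • 1 := by
    rw [aMatrix, ← Matrix.diagonal_one, ← Matrix.diagonal_smul, ← Matrix.diagonal_smul,
      Matrix.diagonal_sub]
    congr 1
    funext j
    by_cases hj : (j : ℕ) < k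
    · simp only [hj, if_true, smul_eq_mul, mul_one, Pi.smul_apply]
      ring
    · simp [hj]
  rw [ha, hinv, mul_sub, sub_mul, mul_smul_comm, smul_mul_assoc, mul_smul_comm, smul_mul_assoc,
    mul_one, Matrix.mem_unitaryGroup_iff.1 hg, map_sub, map_smul, map_smul, map_one, theta,
    sub_left_inj]
  exact smul_right_inj (M := Op n) Complex.I_ne_zero

/-- There is an orthonormal basis of `ℂⁿ` whose first `k` vectors span `V` and whose other vectors
are orthogonal to `V`. -/
lemma exists_adapted_basis (V : Gr k n) (hk : k ≤ n) : ∃ b : OrthonormalBasis (Fin n) ℂ (Cn n),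
    ∀ j : Fin n, V.proj (b j) = (if (j : ℕ) < k then (1 : ℂ) else 0) • b j := by
  set v : Fin n → Cn n := fun j =>
    if h : (j : ℕ) < k then V.e (EuclideanSpace.basisFun (Fin k) ℂ ⟨j, h⟩) else 0 with hv
  set s : Set (Fin n) := {j | (j : ℕ) < k} with hs
  have hv' (i : Fin k) : v (Fin.castLE hk i) = V.e (EuclideanSpace.basisFun (Fin k) ℂ i) := by
    simp [hv]
  have hon : Orthonormal ℂ (s.domRestrict v) := by
    have h1 : Orthonormal ℂ fun i : Fin k => V.e (EuclideanSpace.basisFun (Fin k) ℂ i) :=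
      (EuclideanSpace.basisFun (Fin k) ℂ).orthonormal.comp_linearIsometry V.frame
    have h2 := h1.comp (fun j : s => (⟨j.1, j.2⟩ : Fin k)) fun i j hij =>
      Subtype.ext (Fin.ext (by simpa using hij))
    have h3 : s.domRestrict v = fun j : s => V.e (EuclideanSpace.basisFun (Fin k) ℂ ⟨j.1, j.2⟩) :=
      funext fun j => dif_pos j.2
    rw [h3]
    exact h2
  obtain ⟨b, hb⟩ := hon.exists_orthonormalBasis_extension_of_card_eq
    (by rw [finrank_euclideanSpace_fin, Fintype.card_fin])
  have hb' (i : Fin k) : b (Fin.castLE hk i) = V.e (EuclideanSpace.basisFun (Fin k) ℂ i) := by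
    rw [hb _ (by simp [hs]), hv']
  refine ⟨b, fun j => ?_⟩
  by_cases hj : (j : ℕ) < k
  · have := hb' ⟨j, hj⟩
    rw [show Fin.castLE hk ⟨j, hj⟩ = j from rfl] at this
    rw [if_pos hj, one_smul, this, proj_e]
  · have h0 : adjoint V.e (b j) = 0 := by
      refine InnerProductSpace.ext_inner_left_basis (𝕜 := ℂ)
        (EuclideanSpace.basisFun (Fin k) ℂ).toBasis fun i => ?_
      rw [OrthonormalBasis.coe_toBasis, ContinuousLinearMap.adjoint_inner_right, ← hb',
        inner_zero_right]
      refine b.orthonormal.inner_eq_zero fun hij => hj ?_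
      rw [← hij]
      exact i.2
    rw [if_neg hj, zero_smul, proj_apply, h0, map_zero]

lemma exists_unitary_conj (V : Gr k n) (hk : k ≤ n) : ∃ g ∈ Matrix.unitaryGroup (Fin n) ℂ,
    V.proj = Matrix.toEuclideanCLM (𝕜 := ℂ)
        (g * Matrix.diagonal (fun j : Fin n => if (j : ℕ) < k then 1 else 0) * star g) := by
  obtain ⟨b, hb⟩ := V.exists_adapted_basis hk
  set a := EuclideanSpace.basisFun (Fin n) ℂ with ha
  set g : Matrix (Fin n) (Fin n) ℂ := a.toBasis.toMatrix b with hg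
  set d : Matrix (Fin n) (Fin n) ℂ :=
    Matrix.diagonal (fun j : Fin n => if (j : ℕ) < k then 1 else 0)
  have hgu : g ∈ Matrix.unitaryGroup (Fin n) ℂ := a.toMatrix_orthonormalBasis_mem_unitary b
  refine ⟨g, hgu, ?_⟩
  have hga (j) : Matrix.toEuclideanCLM (𝕜 := ℂ) g (a j) = b j := by
    ext i
    simp [ha, hg, Module.Basis.toMatrix_apply]
  have hda (j) : Matrix.toEuclideanCLM (𝕜 := ℂ) d (a j) =
      (if (j : ℕ) < k then (1 : ℂ) else 0) • a j := by
    ext i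
    by_cases hij : i = j <;> by_cases hj : (j : ℕ) < k <;>
      simp [ha, d, Matrix.mulVec_diagonal, hij, hj]
  have hmul : V.proj * Matrix.toEuclideanCLM (𝕜 := ℂ) g
      = Matrix.toEuclideanCLM (𝕜 := ℂ) g * Matrix.toEuclideanCLM (𝕜 := ℂ) d := by
    refine ContinuousLinearMap.coe_injective (a.toBasis.ext fun j => ?_)
    change V.proj (Matrix.toEuclideanCLM (𝕜 := ℂ) g (a.toBasis j)) =
      Matrix.toEuclideanCLM (𝕜 := ℂ) g (Matrix.toEuclideanCLM (𝕜 := ℂ) d (a.toBasis j))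
    rw [OrthonormalBasis.coe_toBasis, hga, hda, map_smul, hga, hb]
  rw [map_mul, map_mul, ← hmul, mul_assoc, ← map_mul, Matrix.mem_unitaryGroup_iff.1 hgu, map_one,
    mul_one]

lemma exists_eq_proj {g : Matrix (Fin n) (Fin n) ℂ} (hg : g ∈ Matrix.unitaryGroup (Fin n) ℂ)
    (hk : k ≤ n) : ∃ V : Gr k n, V.proj = Matrix.toEuclideanCLM (𝕜 := ℂ)
        (g * Matrix.diagonal (fun j : Fin n => if (j : ℕ) < k then 1 else 0) * star g) := by
  set d : Matrix (Fin n) (Fin n) ℂ :=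
    Matrix.diagonal (fun j : Fin n => if (j : ℕ) < k then 1 else 0)
    with hd
  set M : Matrix (Fin n) (Fin n) ℂ := g * d * star g with hM
  have hdd : d * d = d := by
    rw [hd, Matrix.diagonal_mul_diagonal]
    congr 1
    funext j
    split_ifs <;> simp
  have hds : star d = d := by
    rw [hd, Matrix.star_eq_conjTranspose, Matrix.diagonal_conjTranspose]
    congr 1
    funext j
    by_cases hj : (j : ℕ) < k <;> simp [hj]
  have hMM : M * M = M := by
    calc M * M = g * d * (star g * g) * d * star g := by simp only [hM, mul_assoc]
      _ = g * (d * d) * star g := by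
        rw [Matrix.mem_unitaryGroup_iff'.1 hg, mul_one, mul_assoc g d d]
      _ = M := by rw [hdd]
  have hMs : star M = M := by
    rw [hM, star_mul, star_mul, star_star, hds, mul_assoc]
  set P : Op n := Matrix.toEuclideanCLM (𝕜 := ℂ) M with hP
  have hproj : IsStarProjection P :=
    ⟨by rw [IsIdempotentElem, hP, ← map_mul, hMM], by rw [isSelfAdjoint_iff, hP, ← map_star, hMs]⟩
  -- The range of a projection has the dimension given by its trace.
  have htr : opTrace P = k := by
    rw [opTrace, hP, Matrix.coe_toEuclideanCLM_eq_toEuclideanLin,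
      Matrix.toEuclideanLin_eq_toLin_orthonormal, Matrix.trace_toLin_eq, hM, mul_assoc,
      Matrix.trace_mul_comm, mul_assoc, Matrix.mem_unitaryGroup_iff'.1 hg, mul_one, hd,
      Matrix.trace_diagonal, Finset.sum_boole]
    rw [Fin.card_filter_val_lt, min_eq_right hk]
  have hrank : Module.finrank ℂ P.range = k := by
    have h1 : LinearMap.IsProj P.range (P : Cn n →ₗ[ℂ] Cn n) :=
      LinearMap.IsIdempotentElem.isProj_range _ (by
        have := hproj.isIdempotentElem
        exact congrArg ContinuousLinearMap.toLinearMap this)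
    have h2 := h1.trace
    exact_mod_cast h2.symm.trans htr
  obtain ⟨_, h⟩ := isStarProjection_iff_eq_starProjection_range.1 hproj
  exact ⟨⟨P.range, hrank⟩, h.symm⟩

lemma range_theta (hk : k ≤ n) : Set.range (theta : Gr k n → Op n) = adjointOrbit k n := by
  ext y
  constructor
  · rintro ⟨V, rfl⟩
    obtain ⟨g, hg, h⟩ := V.exists_unitary_conj hk
    exact ⟨g, hg, (V.theta_eq_iff g hg).2 h⟩
  · rintro ⟨g, hg, rfl⟩
    obtain ⟨V, h⟩ := exists_eq_proj hg hk
    exact ⟨V, (V.theta_eq_iff g hg).2 h⟩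

end Gr

end

theorem proposition2p1 (k n : ℕ) (hk : k ≤ n) :
    ∃ (g : RiemMetric (GrModel k n) (Gr k n)) (Θ : Gr k n → Op n),
      -- `g` is the standard metric of the Grassmannian, which is Hermitian symmetric and Kaehler
      (∀ V A B, g.inner V A B = V.fubiniStudy A B) ∧
      IsHermitianSymmetricSpace g ∧
      IsKaehlerMetric g ∧
      -- `Θ` identifies the Grassmannian with the adjoint orbit, as a submanifold
      Set.range Θ = adjointOrbit k n ∧
      (∀ V : Gr k n, Module.End.eigenspace (Θ V : Cn n →ₗ[ℂ] Cn n) (Complex.I / 2) = V.1) ∧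
      ContMDiff 𝓘(ℝ, GrModel k n) 𝓘(ℝ, Op n) ∞ Θ ∧
      Topology.IsEmbedding Θ ∧
      (∀ V, Function.Injective (mfderiv 𝓘(ℝ, GrModel k n) 𝓘(ℝ, Op n) Θ V)) ∧
      -- the metric induced on the orbit by `⟨x, y⟩ = -tr(xy)` is the metric `g`
      (∀ V A B, (g.inner V A B : ℂ) =
        uForm (mfderiv 𝓘(ℝ, GrModel k n) 𝓘(ℝ, Op n) Θ V A)
          (mfderiv 𝓘(ℝ, GrModel k n) 𝓘(ℝ, Op n) Θ V B)) ∧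
      -- the GNLS, for smooth maps from open subsets of the `(x, t)`-plane
      (∀ (U : Set (ℝ × ℝ)) (γ : ℝ × ℝ → Gr k n), IsOpen U →
        (ContMDiffOn 𝓘(ℝ, ℝ × ℝ) 𝓘(ℝ, GrModel k n) ∞ γ U ↔ ContDiffOn ℝ ∞ (Θ ∘ γ) U) ∧
        (ContMDiffOn 𝓘(ℝ, ℝ × ℝ) 𝓘(ℝ, GrModel k n) ∞ γ U →
          ((∀ x t, (x, t) ∈ U → GNLSAt g γ x t) ↔
            ∀ x t, (x, t) ∈ U →
              deriv (fun s => Θ (γ (x, s))) t =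
                ⁅Θ (γ (x, t)), iteratedDeriv 2 (fun r => Θ (γ (r, t))) x⁆))) := by
  refine ⟨Gr.metric k n, Gr.theta, fun V A B => V.metricInner_apply A B,
    Gr.isHermitianSymmetricSpace_metric hk, Gr.isKaehlerMetric_metric, Gr.range_theta hk,
    Gr.eigenspace_theta, Gr.contMDiff_theta, Gr.isEmbedding_theta, Gr.mfderiv_theta_injective,
    Gr.metric_eq_uForm, fun U γ hU => ⟨Gr.contMDiffOn_iff_theta, fun hγ => ?_⟩⟩
  have hP := Gr.contDiffOn_theta_comp_iff.1 (Gr.contMDiffOn_iff_theta.1 hγ)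
  refine forall₃_congr fun x t hxt => ?_
  have h := hP.contDiffAt (hU.mem_nhds hxt)
  refine Gr.gnlsAt_metric_iff ?_ ?_
  · exact ContDiffAt.comp x (f := fun r : ℝ => (r, t)) (h.of_le (by norm_cast))
      (contDiffAt_id.prodMk contDiffAt_const)
  · exact ContDiffAt.comp t (f := fun r : ℝ => (x, r)) (h.of_le (by norm_cast))
      (contDiffAt_const.prodMk contDiffAt_id)
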